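/- **Definitions.** Let $M$ be a matroid (finite or infinite) with closure operator $\mathrm{cl}$. For distinct elements $y,x,z,o,q,r,s$ of $M$ write $\mathrm{HP}(y,x,z;o,q,r,s)$ if the restriction $M|\{y,x,z,o,q,r,s\}$ is either the non-Fano matroid $F_7^-$ whose three-point lines are $$\{y,x,z\},\ \{y,o,q\},\ \{y,r,s\},\ \{z,o,s\},\ \{z,q,r\},\ \{x,q,s\},$$ or the Fano matroid $F_7$ whose three-point lines are these six together with $\{x,o,r\}$. An element $x'$ is a *harmonic conjugate* of $x$ with respect to $y$ and $z$, written $\mathrm{H}(y,z;x,x')$, if there are $o,q,r,s$ with $\mathrm{HP}(y,x,z;o,q,r,s)$ and $\mathrm{cl}(\{y,z\})\cap\mathrm{cl}(\{o,r\})=\{x'\}$. The matroid $M$ is *harmonic* if, whenever $\mathrm{HP}(y,x,z;o,q,r,s)$ holds, $\mathrm{cl}(\{y,z\})\cap\mathrm{cl}(\{o,r\})$ consists of exactly one element $x'$, and $x'$ depends only on $x,y,z$ and not on the choice of $o,q,r,s$. For a set $S$ of elements of a harmonic matroid $M$ put $$h(S)=S\cup\{x\in M:\mathrm{H}(a,c;b,x)\text{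 for some }a,b,c\in S\},\qquad h^\infty(S)=\bigcup_{n\ge 0}h^n(S).$$ Let $p$ be a prime. The matroid $L_p$ is the restriction of $PG(2,p)$ to the union of three concurrent lines; explicitly, in homogeneous coordinates over $\mathbb Z_p$, its ground set is $$\{[0,i,1],[1,i,1],[1,i,0]: i\in\mathbb Z_p\}\cup\{[0,1,0]\}.$$ An *embedding* of $L_p$ in $M$ is an injection $f$ from the ground set of $L_p$ to that of $M$ such that a set $I$ is independent in $L_p$ if and only if $f(I)$ is independent in $M$. **Theorem.** Let $p$ be a prime, let $M$ be a harmonic matroid, and let $f$ be an embedding of $L_p$ in $M$, with image $f(L_p)$. Then $h^\infty(f(L_p))$ is a Desarguesian projective plane of order $p$ in $M$: it is a subset of the ground set of $M$, the restriction $M|h^\infty(f(L_p))$ is a simple matroid of rank $3$, and the elements of $h^\infty(f(L_p))$, as points, together with the rank-$2$ flats of this restriction, as lines, form a projective plane of order $p$ in which Desargues' theorem holds. -/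

import Mathlib

open Set
open scoped LinearAlgebra.Projectivization

namespace HarmonicMatroid

universe u

section General

variable {α : Type u} {β : Type*}

/-- The seven elements of a labelled Fano (or non-Fano) configuration. -/
def hpSet (y x z o q r s : α) : Set α := {y, x, z, o, q, r, s}

/-- The six three-point lines of the labelled non-Fano matroid: in the complete quadrangle
`o, q, r, s`, the opposite sides `oq, rs` meet in `y`, the opposite sides `os, qr` meet in `z`,
and the side `qs` meets the line `yz` in `x`. -/
def nonFanoLines (y x z o q r s : α) : Set (Set α) :=
  {{y, x, z}, {y, o, q}, {y, r, s}, {z, o, s}, {z, q, r}, {x, q, s}}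

/-- The seven three-point lines of the labelled Fano matroid: those of the non-Fano matroid
and `{x, o, r}`. -/
def fanoLines (y x z o q r s : α) : Set (Set α) :=
  insert {x, o, r} (nonFanoLines y x z o q r s)

/-- `HP M y x z o q r s`: the elements are distinct, and the restriction of `M` to them is the
labelled Fano matroid or the labelled non-Fano matroid (the rank-three matroids on seven elements
whose independent sets are the sets of at most three elements other than the listed lines). -/
def HP (M : Matroid α) (y x z o q r s : α) : Prop :=
  [y, x, z, o, q, r, s].Nodup ∧ hpSet y x z o q r s ⊆ M.E ∧
    ((∀ I ⊆ hpSet y x z o q r s,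
        (M.Indep I ↔ I.encard ≤ 3 ∧ I ∉ fanoLines y x z o q r s)) ∨
      (∀ I ⊆ hpSet y x z o q r s,
        (M.Indep I ↔ I.encard ≤ 3 ∧ I ∉ nonFanoLines y x z o q r s)))

/-- `HC M y z x x'`: the element `x'` is a harmonic conjugate of `x` with respect to
`y` and `z`. -/
def HC (M : Matroid α) (y z x x' : α) : Prop :=
  ∃ o q r s, HP M y x z o q r s ∧ M.closure {y, z} ∩ M.closure {o, r} = {x'}

/-- Harmonic matroids: every configuration `HP` gives rise to a harmonic conjugate `x'` of `x`
with respect to `y` and `z`, and `x'` depends only on `x, y, z`. -/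
structure IsHarmonic (M : Matroid α) : Prop where
  exists_conj : ∀ y x z o q r s, HP M y x z o q r s →
    ∃ x', M.closure {y, z} ∩ M.closure {o, r} = {x'}
  unique_conj : ∀ y z x x₁ x₂, HC M y z x x₁ → HC M y z x x₂ → x₁ = x₂

/-- One step of harmonic closure. -/
def harmonicStep (M : Matroid α) (S : Set α) : Set α :=
  S ∪ {x | x ∈ M.E ∧ ∃ a ∈ S, ∃ b ∈ S, ∃ c ∈ S, HC M a c b x}

/-- The harmonic closure `h^∞(S) = ⋃ n, h^n(S)` of `S` in `M`. -/
def harmonicClosure (M : Matroid α) (S : Set α) : Set α :=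
  ⋃ n : ℕ, (harmonicStep M)^[n] S

/-- `f` embeds the matroid `N` in the matroid `M`: it is injective on the ground set of `N` and
is an isomorphism of `N` onto the restriction of `M` to the image. -/
structure IsEmbedding (N : Matroid β) (M : Matroid α) (f : β → α) : Prop where
  injOn : InjOn f N.E
  mapsTo : MapsTo f N.E M.E
  indep_iff : ∀ I ⊆ N.E, (N.Indep I ↔ M.Indep (f '' I))

/-- The lines of a matroid: its flats of rank two. -/
def Line (N : Matroid α) : Type u := {F : Set α // N.IsFlat F ∧ N.eRk F = 2}

instance (N : Matroid α) : Membership N.E (Line N) := ⟨fun l x => (x : α) ∈ l.1⟩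

end General

/-- Three points of an incidence structure that lie on a common line. -/
def Collinear₃ {P : Type*} (L : Type*) [Membership P L] (a b c : P) : Prop :=
  ∃ l : L, a ∈ l ∧ b ∈ l ∧ c ∈ l

/-- Desargues' theorem for an incidence structure of points and lines: if the triangles `abc` and
`a'b'c'` are perspective from `o` (so that `oaa'`, `obb'`, `occ'` lie on three distinct lines
through `o`), then the points `u`, `v`, `w` in which corresponding sides `bc, b'c'`, `ca, c'a'`,
`ab, a'b'` meet are collinear. -/
def Desarguesian (P L : Type*) [Membership P L] : Prop :=
  ∀ (o a b c a' b' c' u v w : P) (l₁ l₂ l₃ m₁ m₂ m₃ n₁ n₂ n₃ : L),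
    -- three distinct lines through the centre
    l₁ ≠ l₂ → l₂ ≠ l₃ → l₁ ≠ l₃ →
    o ∈ l₁ → a ∈ l₁ → a' ∈ l₁ →
    o ∈ l₂ → b ∈ l₂ → b' ∈ l₂ →
    o ∈ l₃ → c ∈ l₃ → c' ∈ l₃ →
    o ≠ a → o ≠ b → o ≠ c → o ≠ a' → o ≠ b' → o ≠ c' →
    a ≠ a' → b ≠ b' → c ≠ c' →
    -- proper triangles
    ¬ Collinear₃ L a b c → ¬ Collinear₃ L a' b' c' →
    -- corresponding sides and their intersections
    b ∈ m₁ → c ∈ m₁ → b' ∈ n₁ → c' ∈ n₁ → u ∈ m₁ → u ∈ n₁ →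
    c ∈ m₂ → a ∈ m₂ → c' ∈ n₂ → a' ∈ n₂ → v ∈ m₂ → v ∈ n₂ →
    a ∈ m₃ → b ∈ m₃ → a' ∈ n₃ → b' ∈ n₃ → w ∈ m₃ → w ∈ n₃ →
    Collinear₃ L u v w

/-- The matroid `N` is a Desarguesian projective plane of order `n`: it is simple of rank three,
and its elements (as points) with its rank-two flats (as lines) form a projective plane of
order `n` in which Desargues' theorem holds. -/
structure IsDesarguesianPlane {α : Type u} (N : Matroid α) (n : ℕ) : Prop where
  simple : ∀ a ∈ N.E, ∀ b ∈ N.E, N.Indep {a, b}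
  rank : N.eRank = 3
  plane : ∃ _ : Configuration.ProjectivePlane N.E (Line N),
    Configuration.ProjectivePlane.order N.E (Line N) = n
  desargues : Desarguesian N.E (Line N)

section PG

variable (p : ℕ) [Fact p.Prime]

/-- The points of `PG(2,p)`. -/
abbrev Point : Type := ℙ (ZMod p) (Fin 3 → ZMod p)

theorem indep_aug {I J : Set (Point p)}
    (hI : Projectivization.Independent (Subtype.val : I → Point p))
    (hJ : Projectivization.Independent (Subtype.val : J → Point p))
    (hIJ : I.ncard < J.ncard) :
    ∃ e ∈ J, e ∉ I ∧
      Projectivization.Independent (Subtype.val : ↥(insert e I) → Point p) := by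
  rw [Projectivization.independent_iff] at hI hJ
  change LinearIndepOn (ZMod p) Projectivization.rep I at hI
  change LinearIndepOn (ZMod p) Projectivization.rep J at hJ
  by_contra! hcon
  have hsub : ∀ e ∈ J, e.rep ∈ Submodule.span (ZMod p) (Projectivization.rep '' I) := by
    intro e he
    by_cases heI : e ∈ I
    · exact Submodule.subset_span (mem_image_of_mem _ heI)
    · by_contra hspan
      apply hcon e he heI
      rw [Projectivization.independent_iff]
      exact hI.insert hspan
  have hle : Submodule.span (ZMod p) (Projectivization.rep '' J) ≤
      Submodule.span (ZMod p) (Projectivization.rep '' I) := by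
    rw [Submodule.span_le]
    rintro _ ⟨e, he, rfl⟩
    exact hsub e he
  have h := Submodule.finrank_mono hle
  have hc : ∀ K : Set (Point p), LinearIndepOn (ZMod p) Projectivization.rep K →
      Module.finrank (ZMod p) (Submodule.span (ZMod p) (Projectivization.rep '' K)) =
        K.ncard := by
    intro K hK
    classical
    have : Fintype K := Fintype.ofFinite K
    have h1 := finrank_span_eq_card (R := ZMod p) hK
    rw [← image_eq_range] at h1
    rw [h1, ← Nat.card_coe_set_eq, Nat.card_eq_fintype_card]
  rw [hc J hJ, hc I hI] at h
  omega

/-- The matroid `PG(2,p)`: a set of points is independent when representing vectors in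
`(ℤ/p)³` are linearly independent. -/
def PG2 : Matroid (Point p) :=
  (IndepMatroid.ofFinite (E := univ) finite_univ
    (fun I => Projectivization.Independent (Subtype.val : I → Point p))
    (by
      rw [Projectivization.independent_iff]
      exact linearIndependent_empty_type)
    (by
      intro I J hJ hIJ
      rw [Projectivization.independent_iff] at hJ ⊢
      exact LinearIndepOn.mono (v := Projectivization.rep) hJ hIJ)
    (fun I J hI hJ h => indep_aug p hI hJ h)
    (fun I _ => subset_univ I)).matroid

/-- The point with homogeneous coordinates `[0, i, 1]`. -/
def ptA (i : ZMod p) : Point p :=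
  Projectivization.mk (ZMod p) ![0, i, 1] fun h => by simpa using congrFun h 2

/-- The point with homogeneous coordinates `[1, i, 1]`. -/
def ptB (i : ZMod p) : Point p :=
  Projectivization.mk (ZMod p) ![1, i, 1] fun h => by simpa using congrFun h 2

/-- The point with homogeneous coordinates `[1, i, 0]`. -/
def ptC (i : ZMod p) : Point p :=
  Projectivization.mk (ZMod p) ![1, i, 0] fun h => by simpa using congrFun h 0

/-- The point with homogeneous coordinates `[0, 1, 0]`. -/
def ptD : Point p :=
  Projectivization.mk (ZMod p) ![0, 1, 0] fun h => by simpa using congrFun h 1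

/-- The union of the three concurrent lines `x = 0`, `x = z`, `z = 0` of `PG(2,p)`,
which meet in `[0, 1, 0]`. -/
def LpGround : Set (Point p) :=
  range (ptA p) ∪ range (ptB p) ∪ range (ptC p) ∪ {ptD p}

/-- The matroid `L_p`: the restriction of `PG(2,p)` to three concurrent lines. -/
def Lp : Matroid (Point p) := (PG2 p).restrict (LpGround p)

end PG

end HarmonicMatroid

/-! Let `D` be the image of `[0,1,0]` and `U`, `V`, `W` the images of the other points of the three
lines. After a change of sign on `V`, the points `U i`, `V j`, `W k` are collinear exactly when `i +
j + k = 0`. Regard `W` as the line at infinity, with `W s` the direction of slope `s`, and `U`, `V`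
as the lines `x = 0` and `x = 1`. Harmonic conjugation with respect to a point and a point at
infinity is reflection, so it should carry `x = 0` across `x = 1` to `x = 2`.

Accordingly let `T m` be the conjugate of `U (-m)` with respect to `V m` and `W 0`. There are `p -
1` quadrangles with this base triple and with vertex `D`; since the conjugate does not depend on the
quadrangle, `T m` lies on all `p` lines through `V (m + k)` and `W k` (`Conf.exists_conjLine`). The
delicate point is that the `T m` lie on one line through `D` (`Conf.col_conj`, `p` odd): `D` is the
conjugate of the midpoint of two points of `U` (`Conf.exists_quad_center`), and a second quadrangle
on the same three points has the line through `T m` and `T n` as the side that must contain this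
conjugate. So `V`, `T`, `W` are again as in `L_p` (`Conf.next`), and iteration produces the lines `x
= 0, ..., p - 1`; for `p = 2` no step is needed.

Chaining the incidences of neighbouring lines gives an affine plane (`Conf.exists_affineConf`),
hence a map from `PG(2,p)` to `M` (`AffineConf.planeMap`) whose image is a copy of `PG(2,p)`
(`PlaneMap.isDesarguesianPlane`). The image consists of iterated conjugates, and it is harmonically
closed because three distinct collinear points of a plane always have a quadrangle inside the plane
(`PlaneMap.mem_range_of_hc`). So it equals the harmonic closure. -/

namespace HarmonicMatroid

universe u

/-! ### Collinearity and parallelism through rank -/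

section Collinearity

variable {α : Type u} {M : Matroid α} {a b c d e : α}

/-- Three elements of a matroid that span a set of rank at most two. -/
def Col (M : Matroid α) (a b c : α) : Prop := M.eRk {a, b, c} ≤ 2

/-- Two elements of a matroid that span a set of rank at most one. -/
def Par (M : Matroid α) (a b : α) : Prop := M.eRk {a, b} ≤ 1

theorem Par.symm (h : Par M a b) : Par M b a := by
  rwa [Par, pair_comm]

theorem par_self (M : Matroid α) (a : α) : Par M a a := by
  simp [Par, Matroid.eRk_singleton_le]

theorem Col.swap (h : Col M a b c) : Col M b a c := by
  rwa [Col, insert_comm]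

theorem Col.swap_right (h : Col M a b c) : Col M a c b := by
  rwa [Col, pair_comm]

theorem Col.rotate (h : Col M a b c) : Col M b c a := h.swap.swap_right

theorem col_swap : Col M a b c ↔ Col M b a c := ⟨Col.swap, Col.swap⟩

theorem col_swap_right : Col M a b c ↔ Col M a c b := ⟨Col.swap_right, Col.swap_right⟩

theorem Par.col (h : Par M a b) (c : α) : Col M a b c := by
  rw [Col, pair_comm b c, insert_comm a c]
  exact (M.eRk_insert_le_add_one c {a, b}).trans
    ((add_le_add_left h 1).trans (by norm_num))

theorem col_left (M : Matroid α) (a b : α) : Col M a b a :=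
  ((par_self M a).col b).swap_right

theorem col_right (M : Matroid α) (a b : α) : Col M a b b :=
  ((par_self M b).col a).rotate.rotate

theorem not_par_of_not_col (h : ¬ Col M a b c) : ¬ Par M a b := fun h' => h (h'.col c)

theorem encard_pair_le_two (a b : α) : ({a, b} : Set α).encard ≤ 2 := by
  refine (encard_insert_le _ _).trans ?_
  rw [encard_singleton]
  norm_num

theorem two_le_eRk_of_not_par (h : ¬ Par M a b) : 2 ≤ M.eRk {a, b} :=
  le_trans (by norm_num) (Order.add_one_le_of_lt (not_le.1 h))

/-- Submodularity: the intersection already has rank 2, so the union has rank at most 2 + 2 - 2. -/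
theorem eRk_union_le_two {X Y : Set α} (h : ¬ Par M a b) (hX : M.eRk X ≤ 2) (hY : M.eRk Y ≤ 2)
    (hXY : {a, b} ⊆ X ∩ Y) : M.eRk (X ∪ Y) ≤ 2 := by
  have h2 := (two_le_eRk_of_not_par h).trans (M.eRk_mono hXY)
  have h5 : 2 + M.eRk (X ∪ Y) ≤ 2 + 2 :=
    ((add_le_add_left h2 _).trans (M.eRk_inter_add_eRk_union_le X Y)).trans (add_le_add hX hY)
  exact (ENat.add_le_add_iff_left (by simp)).1 h5

theorem Col.trans (h : ¬ Par M a b) (hc : Col M a b c) (hd : Col M a b d) : Col M a c d :=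
  (M.eRk_mono (by rintro x (rfl | rfl | rfl) <;> simp)).trans
    (eRk_union_le_two h hc hd (by rintro x (rfl | rfl) <;> simp))

/-- Three points on the line through two non-parallel points are collinear. -/
theorem Col.trans₃ (h : ¬ Par M a b) (hc : Col M a b c) (hd : Col M a b d) (he : Col M a b e) :
    Col M c d e :=
  (M.eRk_mono (by rintro x (rfl | rfl | rfl) <;> simp)).trans
    (eRk_union_le_two h (eRk_union_le_two h hc hd (by rintro x (rfl | rfl) <;> simp)) he
      (by rintro x (rfl | rfl) <;> simp))

/-- The middle element must not be a loop, since a loop is parallel to everything. -/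
theorem Par.trans (hb : M.IsNonloop b) (h : Par M a b) (h' : Par M b c) : Par M a c := by
  have hsub := M.eRk_inter_add_eRk_union_le {a, b} {b, c}
  have hle : 1 ≤ M.eRk ({a, b} ∩ {b, c}) := by
    rw [← hb.eRk_eq]
    exact M.eRk_mono (by simp)
  have h5 : 1 + M.eRk ({a, b} ∪ {b, c}) ≤ 1 + 1 :=
    ((add_le_add_left hle _).trans hsub).trans (add_le_add h h')
  exact (M.eRk_mono (by rintro x (rfl | rfl) <;> simp)).trans
    ((ENat.add_le_add_iff_left (by simp)).1 h5)

/-- A point parallel to a point of a line lies on the line. -/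
theorem Par.col_of_col (ha : M.IsNonloop a) (h : Par M a b) (hc : Col M a c d) : Col M b c d := by
  have hsub := M.eRk_inter_add_eRk_union_le {a, b} {a, c, d}
  have hle : 1 ≤ M.eRk ({a, b} ∩ {a, c, d}) := by
    rw [← ha.eRk_eq]
    exact M.eRk_mono (by simp)
  have h5 : 1 + M.eRk ({a, b} ∪ {a, c, d}) ≤ 1 + 2 :=
    ((add_le_add_left hle _).trans hsub).trans (add_le_add h hc)
  exact (M.eRk_mono (by rintro x (rfl | rfl | rfl) <;> simp)).trans
    ((ENat.add_le_add_iff_left (by simp)).1 h5)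

theorem indep_pair_of_not_par (h : ¬ Par M a b) : M.Indep {a, b} := by
  rw [Matroid.indep_iff_eRk_eq_encard_of_finite (by simp)]
  exact (M.eRk_le_encard _).antisymm
    ((encard_pair_le_two a b).trans (two_le_eRk_of_not_par h))

theorem isNonloop_left_of_not_par (h : ¬ Par M a b) : M.IsNonloop a :=
  (indep_pair_of_not_par h).isNonloop_of_mem (by simp)

theorem isNonloop_right_of_not_par (h : ¬ Par M a b) : M.IsNonloop b :=
  (indep_pair_of_not_par h).isNonloop_of_mem (by simp)

theorem ne_of_not_par (h : ¬ Par M a b) : a ≠ b := fun hab => h (hab ▸ par_self M a)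

theorem indep_triple_of_not_col (h : ¬ Col M a b c) : M.Indep {a, b, c} := by
  rw [Matroid.indep_iff_eRk_eq_encard_of_finite (by simp)]
  have h3 : 3 ≤ M.eRk {a, b, c} := le_trans (by norm_num) (Order.add_one_le_of_lt (not_le.1 h))
  refine (M.eRk_le_encard _).antisymm (le_trans ?_ h3)
  refine (encard_insert_le _ _).trans ?_
  exact (add_le_add_left (encard_pair_le_two b c) 1).trans (by norm_num)

theorem not_col_of_indep (h : M.Indep {a, b, c}) (hab : a ≠ b) (hac : a ≠ c) (hbc : b ≠ c) :
    ¬ Col M a b c := by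
  rw [Col, h.eRk_eq_encard, encard_insert_of_notMem (by simp [hab, hac]), encard_pair hbc]
  norm_num

theorem Col.mem_closure (h : ¬ Par M a b) (hc : c ∈ M.E) (hcol : Col M a b c) :
    c ∈ M.closure {a, b} := by
  by_contra hcl
  have h3 := M.eRk_insert_eq_add_one (X := {a, b}) ⟨hc, hcl⟩
  have h4 : M.eRk {a, b} + 1 ≤ 2 := by
    rw [← h3]
    exact hcol.rotate.rotate
  have h5 : (2 : ℕ∞) + 1 ≤ 2 := (add_le_add_left (two_le_eRk_of_not_par h) 1).trans h4
  exact absurd h5 (by norm_num)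

theorem col_of_mem_closure (h : c ∈ M.closure {a, b}) : Col M a b c := by
  have h1 : M.eRk {a, b, c} ≤ M.eRk (M.closure {a, b}) := by
    -- Neither `a` nor `b` is assumed to lie in the ground set; elements outside it do not affect
    -- the rank.
    rw [← M.eRk_inter_ground]
    refine M.eRk_mono ?_
    have h2 := M.inter_ground_subset_closure {a, b}
    rintro x ⟨rfl | rfl | rfl, hx⟩
    · exact h2 ⟨by simp, hx⟩
    · exact h2 ⟨by simp, hx⟩
    · exact h
  rw [M.eRk_closure_eq] at h1
  exact h1.trans ((M.eRk_le_encard _).trans (encard_pair_le_two a b))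

end Collinearity

/-! ### Quadrangles and the Fano and non-Fano restrictions -/

section Quadrangle

variable {α : Type u} {M : Matroid α} {y x z o q r s a b c d e t : α}

/-- A diagonal point of a quadrangle lies on no further side. -/
theorem not_col_of_diagonal (ht : M.IsNonloop t) (h₁ : Col M t a b) (h₂ : Col M t c d)
    (h : ¬ Col M a b c) (h' : ¬ Col M a c d) : ¬ Col M t a c := by
  intro hc
  by_cases hta : Par M t a
  -- If `t` is parallel to `a`, then `a` itself lies on `cd`. Otherwise `t` and `a` span a line
  -- containing `b` and `c`.
  · exact h' (hta.col_of_col ht h₂)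
  · exact h (Col.trans (fun hp => hta hp.symm) h₁.swap hc.swap)

/-- A complete quadrangle `o, q, r, s` with diagonal points `y = oq ∩ rs` and `z = os ∩ qr`,
and the point `x` in which the side `qs` meets the line `yz`. -/
structure Quad (M : Matroid α) (y x z o q r s : α) : Prop where
  oqr : ¬ Col M o q r
  oqs : ¬ Col M o q s
  ors : ¬ Col M o r s
  qrs : ¬ Col M q r s
  yoq : Col M y o q
  yrs : Col M y r s
  zos : Col M z o s
  zqr : Col M z q r
  xqs : Col M x q s
  yxz : Col M y x z
  hy : M.IsNonloop y
  hx : M.IsNonloop x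
  hz : M.IsNonloop z

/-- A property of triples that is invariant under permutations holds for any three distinct
members of a list if it holds for the members in the order of the list. -/
theorem forall_of_triplewise {Q : α → α → α → Prop} (h₁ : ∀ a b c, Q a b c → Q b a c)
    (h₂ : ∀ a b c, Q a b c → Q a c b) {l : List α} (h : l.Triplewise Q) :
    ∀ a ∈ l, ∀ b ∈ l, ∀ c ∈ l, a ≠ b → a ≠ c → b ≠ c → Q a b c := by
  induction h with
  | nil => simp
  | @cons e l hp _ ih =>
    have key : ∀ b ∈ l, ∀ c ∈ l, b ≠ c → Q e b c := fun b hb c hc hbc =>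
      haveI : Std.Symm (Q e) := ⟨fun a b h => h₂ e a b h⟩
      hp.forall hb hc hbc
    intro a ha b hb c hc hab hac hbc
    rcases List.mem_cons.1 ha with rfl | ha' <;> rcases List.mem_cons.1 hb with rfl | hb' <;>
      rcases List.mem_cons.1 hc with rfl | hc'
    all_goals first
      | exact absurd rfl ‹_›
      | exact key _ ‹_› _ ‹_› ‹_›
      | exact h₁ _ _ _ (key _ ha' _ hc' hac)
      | exact h₂ _ _ _ (h₁ _ _ _ (key _ ha' _ hb' hab))
      | exact ih a ‹_› b ‹_› c ‹_› hab hac hbc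

/-- The independent sets of a restriction to finitely many points of a plane are determined by
the collinear triples. -/
theorem indep_iff_of_triplewise {l : List α} {L : Set (Set α)}
    (hrk : M.eRk {a | a ∈ l} ≤ 3) (hpar : ∀ a ∈ l, ∀ b ∈ l, a ≠ b → ¬ Par M a b)
    (hne : ∀ a ∈ l, M.IsNonloop a) (hL : ∀ I ∈ L, M.eRk I ≤ 2 ∧ I.encard = 3)
    (h : l.Triplewise fun a b c => Col M a b c → {a, b, c} ∈ L) {I : Set α}
    (hI : I ⊆ {a | a ∈ l}) : M.Indep I ↔ I.encard ≤ 3 ∧ I ∉ L := by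
  constructor
  · intro hi
    refine ⟨hi.eRk_eq_encard ▸ (M.eRk_mono hI).trans hrk, fun hIL => ?_⟩
    obtain ⟨h1, h2⟩ := hL I hIL
    rw [hi.eRk_eq_encard, h2] at h1
    exact absurd h1 (by norm_num)
  · rintro ⟨hcard, hIL⟩
    rcases hcard.lt_or_eq with hlt | heq
    · have h2 : I.encard ≤ 2 := Order.le_of_lt_add_one (hlt.trans_eq (by norm_num))
      rcases h2.lt_or_eq with hlt | heq
      · have h1 : I.encard ≤ 1 := Order.le_of_lt_add_one (hlt.trans_eq (by norm_num))
        rcases encard_le_one_iff_eq.1 h1 with rfl | ⟨a, rfl⟩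
        · exact M.empty_indep
        · exact (hne a (hI rfl)).indep
      · obtain ⟨a, b, hab, rfl⟩ := encard_eq_two.1 heq
        exact indep_pair_of_not_par (hpar a (hI (by simp)) b (hI (by simp)) hab)
    · obtain ⟨a, b, c, hab, hac, hbc, rfl⟩ := encard_eq_three.1 heq
      refine indep_triple_of_not_col fun hcol => hIL ?_
      refine forall_of_triplewise (l := l) (Q := fun a b c => Col M a b c → {a, b, c} ∈ L)
        ?_ ?_ h a (hI (by simp)) b (hI (by simp)) c (hI (by simp)) hab hac hbc hcol
      · intro a b c h hc
        rw [insert_comm]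
        exact h hc.swap
      · intro a b c h hc
        rw [pair_comm]
        exact h hc.swap_right

/-- If `y ∈ ea` and `z ∈ eb` for distinct lines `ea` and `eb`, then `e` is not on `yz`. -/
theorem not_col_of_two_lines (h₁ : Col M y e a) (h₂ : Col M z e b) (h : ¬ Col M e a b)
    (hy : ¬ Par M y e) (hz : ¬ Par M z e) : ¬ Col M y z e := by
  intro h₆
  have h₇ : Col M e a z := Col.trans (fun h => hy h.symm) h₁.swap h₆.rotate.rotate
  exact h (Col.trans (fun h => hz h.symm) h₇.swap_right h₂.swap)

/-- A point that is not on the line `xy` stays off it when moved on a line through `y`. -/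
theorem not_col_of_col (hy : ¬ Par M y e) (h₁ : Col M y e a) (h : ¬ Col M y x a) :
    ¬ Col M y x e :=
  fun h' => h (Col.trans hy h'.swap_right h₁)

set_option linter.unusedSimpArgs false in
-- Of the 35 triples, six are the lines in `Quad` and four are the triples of vertices. All others
-- except `{x, o, r}` are forced to be non-collinear, and that one decides between Fano and
-- non-Fano.
theorem Quad.hp (h : Quad M y x z o q r s) : HP M y x z o q r s := by
  obtain ⟨oqr, oqs, ors, qrs, yoq, yrs, zos, zqr, xqs, yxz, hy, hx, hz⟩ := h
  -- The diagonal points `y` and `z` lie on no sides other than their own two.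
  have yor : ¬ Col M y o r := by
    refine not_col_of_diagonal (b := q) (d := s) hy ?_ ?_ ?_ ?_ <;>
      simp_all only [col_swap, col_swap_right, not_false_eq_true]
  have yos : ¬ Col M y o s := by
    refine not_col_of_diagonal (b := q) (d := r) hy ?_ ?_ ?_ ?_ <;>
      simp_all only [col_swap, col_swap_right, not_false_eq_true]
  have yqr : ¬ Col M y q r := by
    refine not_col_of_diagonal (b := o) (d := s) hy ?_ ?_ ?_ ?_ <;>
      simp_all only [col_swap, col_swap_right, not_false_eq_true]
  have yqs : ¬ Col M y q s := by
    refine not_col_of_diagonal (b := o) (d := r) hy ?_ ?_ ?_ ?_ <;>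
      simp_all only [col_swap, col_swap_right, not_false_eq_true]
  have zoq : ¬ Col M z o q := by
    refine not_col_of_diagonal (b := s) (d := r) hz ?_ ?_ ?_ ?_ <;>
      simp_all only [col_swap, col_swap_right, not_false_eq_true]
  have zor : ¬ Col M z o r := by
    refine not_col_of_diagonal (b := s) (d := q) hz ?_ ?_ ?_ ?_ <;>
      simp_all only [col_swap, col_swap_right, not_false_eq_true]
  have zqs : ¬ Col M z q s := by
    have : ¬ Col M z s q := by
      refine not_col_of_diagonal (b := o) (d := r) hz ?_ ?_ ?_ ?_ <;>
        simp_all only [col_swap, col_swap_right, not_false_eq_true]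
    simp_all only [col_swap, col_swap_right, not_false_eq_true]
  have zrs : ¬ Col M z r s := by
    have : ¬ Col M z s r := by
      refine not_col_of_diagonal (b := o) (d := q) hz ?_ ?_ ?_ ?_ <;>
        simp_all only [col_swap, col_swap_right, not_false_eq_true]
    simp_all only [col_swap, col_swap_right, not_false_eq_true]
  have pyo : ¬ Par M y o := by
    refine not_par_of_not_col (c := r) ?_
    simp_all only [col_swap, col_swap_right, not_false_eq_true]
  have pyq : ¬ Par M y q := by
    refine not_par_of_not_col (c := r) ?_
    simp_all only [col_swap, col_swap_right, not_false_eq_true]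
  have pyr : ¬ Par M y r := by
    refine not_par_of_not_col (c := o) ?_
    simp_all only [col_swap, col_swap_right, not_false_eq_true]
  have pys : ¬ Par M y s := by
    refine not_par_of_not_col (c := o) ?_
    simp_all only [col_swap, col_swap_right, not_false_eq_true]
  have pzo : ¬ Par M z o := by
    refine not_par_of_not_col (c := q) ?_
    simp_all only [col_swap, col_swap_right, not_false_eq_true]
  have pzq : ¬ Par M z q := by
    refine not_par_of_not_col (c := o) ?_
    simp_all only [col_swap, col_swap_right, not_false_eq_true]
  have pzr : ¬ Par M z r := by
    refine not_par_of_not_col (c := o) ?_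
    simp_all only [col_swap, col_swap_right, not_false_eq_true]
  have pzs : ¬ Par M z s := by
    refine not_par_of_not_col (c := q) ?_
    simp_all only [col_swap, col_swap_right, not_false_eq_true]
  have yzo : ¬ Col M y z o := by
    refine not_col_of_two_lines (a := q) (b := s) ?_ ?_ ?_ pyo pzo <;>
      simp_all only [col_swap, col_swap_right, not_false_eq_true]
  have yzq : ¬ Col M y z q := by
    refine not_col_of_two_lines (a := o) (b := r) ?_ ?_ ?_ pyq pzq <;>
      simp_all only [col_swap, col_swap_right, not_false_eq_true]
  have yzr : ¬ Col M y z r := by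
    refine not_col_of_two_lines (a := s) (b := q) ?_ ?_ ?_ pyr pzr <;>
      simp_all only [col_swap, col_swap_right, not_false_eq_true]
  have yzs : ¬ Col M y z s := by
    refine not_col_of_two_lines (a := r) (b := o) ?_ ?_ ?_ pys pzs <;>
      simp_all only [col_swap, col_swap_right, not_false_eq_true]
  -- Here `x` is used as a diagonal point of the quadrangle `q, s, y, z`, being the meet of `qs` and
  -- `yz`.
  have yxq : ¬ Col M y x q := by
    have : ¬ Col M x q y := by
      refine not_col_of_diagonal (b := s) (d := z) hx ?_ ?_ ?_ ?_ <;>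
        simp_all only [col_swap, col_swap_right, not_false_eq_true]
    simp_all only [col_swap, col_swap_right, not_false_eq_true]
  have yxs : ¬ Col M y x s := by
    have : ¬ Col M x s y := by
      refine not_col_of_diagonal (b := q) (d := z) hx ?_ ?_ ?_ ?_ <;>
        simp_all only [col_swap, col_swap_right, not_false_eq_true]
    simp_all only [col_swap, col_swap_right, not_false_eq_true]
  have xzq : ¬ Col M x z q := by
    have : ¬ Col M x q z := by
      refine not_col_of_diagonal (b := s) (d := y) hx ?_ ?_ ?_ ?_ <;>
        simp_all only [col_swap, col_swap_right, not_false_eq_true]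
    simp_all only [col_swap, col_swap_right, not_false_eq_true]
  have xzs : ¬ Col M x z s := by
    have : ¬ Col M x s z := by
      refine not_col_of_diagonal (b := q) (d := y) hx ?_ ?_ ?_ ?_ <;>
        simp_all only [col_swap, col_swap_right, not_false_eq_true]
    simp_all only [col_swap, col_swap_right, not_false_eq_true]
  have yxo : ¬ Col M y x o := by
    have : ¬ Col M y x o := by
      refine not_col_of_col (x := x) (a := q) pyo ?_ ?_ <;>
        simp_all only [col_swap, col_swap_right, not_false_eq_true]
    simp_all only [col_swap, col_swap_right, not_false_eq_true]
  have yxr : ¬ Col M y x r := by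
    have : ¬ Col M y x r := by
      refine not_col_of_col (x := x) (a := s) pyr ?_ ?_ <;>
        simp_all only [col_swap, col_swap_right, not_false_eq_true]
    simp_all only [col_swap, col_swap_right, not_false_eq_true]
  have xzo : ¬ Col M x z o := by
    have : ¬ Col M z x o := by
      refine not_col_of_col (x := x) (a := s) pzo ?_ ?_ <;>
        simp_all only [col_swap, col_swap_right, not_false_eq_true]
    simp_all only [col_swap, col_swap_right, not_false_eq_true]
  have xzr : ¬ Col M x z r := by
    have : ¬ Col M z x r := by
      refine not_col_of_col (x := x) (a := q) pzr ?_ ?_ <;>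
        simp_all only [col_swap, col_swap_right, not_false_eq_true]
    simp_all only [col_swap, col_swap_right, not_false_eq_true]
  -- If `x` were on a further side, that side would contain `x` and a diagonal point, hence be the
  -- line `yz`; but `yz` contains no vertex.
  have xoq : ¬ Col M x o q := by
    intro h
    have : Col M o x y := by
      refine Col.trans (a := o) (b := q) (c := x) (d := y) (not_par_of_not_col (c := r) ?_) ?_ ?_ <;>
        simp_all only [col_swap, col_swap_right, not_false_eq_true]
    simp_all only [col_swap, col_swap_right, not_false_eq_true]
  have xos : ¬ Col M x o s := by
    intro h
    have : Col M o x z := by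
      refine Col.trans (a := o) (b := s) (c := x) (d := z) (not_par_of_not_col (c := r) ?_) ?_ ?_ <;>
        simp_all only [col_swap, col_swap_right, not_false_eq_true]
    simp_all only [col_swap, col_swap_right, not_false_eq_true]
  have xqr : ¬ Col M x q r := by
    intro h
    have : Col M q x z := by
      refine Col.trans (a := q) (b := r) (c := x) (d := z) (not_par_of_not_col (c := o) ?_) ?_ ?_ <;>
        simp_all only [col_swap, col_swap_right, not_false_eq_true]
    simp_all only [col_swap, col_swap_right, not_false_eq_true]
  have xrs : ¬ Col M x r s := by
    intro h
    have : Col M r x y := by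
      refine Col.trans (a := r) (b := s) (c := x) (d := y) (not_par_of_not_col (c := q) ?_) ?_ ?_ <;>
        simp_all only [col_swap, col_swap_right, not_false_eq_true]
    simp_all only [col_swap, col_swap_right, not_false_eq_true]
  have pyz : ¬ Par M y z := not_par_of_not_col yzo
  have pyx : ¬ Par M y x := not_par_of_not_col yxo
  have pxz : ¬ Par M x z := not_par_of_not_col xzo
  have poq : ¬ Par M o q := not_par_of_not_col oqr
  have por : ¬ Par M o r := not_par_of_not_col ors
  have pos : ¬ Par M o s := fun h => ors (h.col r).swap_right
  have pqr : ¬ Par M q r := not_par_of_not_col qrs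
  have pqs : ¬ Par M q s := fun h => qrs (h.col r).swap_right
  have prs : ¬ Par M r s := fun h => qrs (h.col q).rotate.rotate
  have pxo : ¬ Par M x o := not_par_of_not_col xoq
  have pxq : ¬ Par M x q := not_par_of_not_col xqr
  have pxr : ¬ Par M x r := not_par_of_not_col xrs
  have pxs : ¬ Par M x s := fun h => xrs (h.col r).swap_right
  have hpar : [y, x, z, o, q, r, s].Pairwise fun a b => ¬ Par M a b := by
    simp [*]
  have hnd : [y, x, z, o, q, r, s].Nodup := hpar.imp ne_of_not_par
  have hset : hpSet y x z o q r s = {a | a ∈ [y, x, z, o, q, r, s]} := by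
    ext a
    simp [hpSet]
  have hloop : ∀ a ∈ [y, x, z, o, q, r, s], M.IsNonloop a := by
    simp [hy, hx, hz, isNonloop_left_of_not_par poq, isNonloop_left_of_not_par pqr,
      isNonloop_left_of_not_par prs, isNonloop_right_of_not_par prs]
  have hpar' : ∀ a ∈ [y, x, z, o, q, r, s], ∀ b ∈ [y, x, z, o, q, r, s], a ≠ b →
      ¬ Par M a b := fun a ha b hb hab =>
    haveI : Std.Symm fun a b => ¬ Par M a b := ⟨fun _ _ h h' => h h'.symm⟩
    hpar.forall ha hb hab
  have hE : hpSet y x z o q r s ⊆ M.E := by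
    rw [hset]
    exact fun a ha => (hloop a ha).mem_ground
  -- Everything is generated from `o, q, r`: first `y` on `oq`, then `s` on `yr`, then `x` on `qs`
  -- and `z` on `os`.
  have hrk : M.eRk {a | a ∈ [y, x, z, o, q, r, s]} ≤ 3 := by
    have hE' : ∀ a ∈ [y, x, z, o, q, r, s], a ∈ M.E := fun a ha => (hloop a ha).mem_ground
    have hF : ∀ {a b c : α}, a ∈ M.closure {o, q, r} → b ∈ M.closure {o, q, r} →
        ¬ Par M a b → c ∈ [y, x, z, o, q, r, s] → Col M a b c → c ∈ M.closure {o, q, r} := by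
      intro a b c ha hb hab hc hcol
      have h1 : M.closure {a, b} ⊆ M.closure {o, q, r} :=
        M.closure_subset_closure_of_subset_closure (by rintro t (rfl | rfl) <;> assumption)
      exact h1 (hcol.mem_closure hab (hE' c hc))
    have hsub : ({o, q, r} : Set α) ⊆ M.closure {o, q, r} := M.subset_closure _
      (by rintro t (rfl | rfl | rfl) <;> exact hE' _ (by simp))
    have ho := hsub (show o ∈ ({o, q, r} : Set α) by simp)
    have hq := hsub (show q ∈ ({o, q, r} : Set α) by simp)
    have hr := hsub (show r ∈ ({o, q, r} : Set α) by simp)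
    have hy' := hF ho hq poq (c := y) (by simp) yoq.rotate
    have hs := hF hy' hr pyr (c := s) (by simp) yrs
    have hx' := hF hq hs pqs (c := x) (by simp) xqs.rotate
    have hz' := hF ho hs pos (c := z) (by simp) zos.rotate
    calc M.eRk {a | a ∈ [y, x, z, o, q, r, s]} ≤ M.eRk (M.closure {o, q, r}) := by
          refine M.eRk_mono fun a ha => ?_
          have : a = y ∨ a = x ∨ a = z ∨ a = o ∨ a = q ∨ a = r ∨ a = s := by simpa using ha
          rcases this with rfl | rfl | rfl | rfl | rfl | rfl | rfl <;> assumption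
      _ = M.eRk {o, q, r} := M.eRk_closure_eq _
      _ ≤ ({o, q, r} : Set α).encard := M.eRk_le_encard _
      _ ≤ 3 := (encard_insert_le _ _).trans
          ((add_le_add_left (encard_pair_le_two q r) 1).trans (by norm_num))
  have hnd' := hnd
  simp only [List.nodup_cons, List.mem_cons, List.not_mem_nil, not_or, or_false] at hnd'
  obtain ⟨⟨n1, n2, n3, n4, n5, n6⟩, ⟨n7, n8, n9, n10, n11⟩, ⟨n12, n13, n14, n15⟩,
    ⟨n16, n17, n18⟩, ⟨n19, n20⟩, n21, -⟩ := hnd'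
  have e3 : ∀ {a b c : α}, a ≠ b → a ≠ c → b ≠ c → ({a, b, c} : Set α).encard = 3 :=
    fun hab hac hbc => encard_eq_three.2 ⟨_, _, _, hab, hac, hbc, rfl⟩
  have hN : ∀ I ∈ nonFanoLines y x z o q r s, M.eRk I ≤ 2 ∧ I.encard = 3 := by
    rintro I (rfl | rfl | rfl | rfl | rfl | rfl)
    exacts [⟨yxz, e3 n1 n2 n7⟩, ⟨yoq, e3 n3 n4 n16⟩, ⟨yrs, e3 n5 n6 n21⟩,
      ⟨zos, e3 n12 n15 n18⟩, ⟨zqr, e3 n13 n14 n19⟩, ⟨xqs, e3 n9 n11 n20⟩]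
  have hT : [y, x, z, o, q, r, s].Triplewise fun a b c =>
      Col M a b c → {a, b, c} ∈ fanoLines y x z o q r s := by
    simp only [List.triplewise_cons, List.pairwise_cons, List.forall_mem_cons,
      List.not_mem_nil, IsEmpty.forall_iff, implies_true, and_true, List.Pairwise.nil,
      List.Triplewise.nil]
    simp [*, fanoLines, nonFanoLines]
  refine ⟨hnd, hE, ?_⟩
  by_cases hxor : Col M x o r
  · left
    rw [hset]
    refine fun I hI => indep_iff_of_triplewise hrk hpar' hloop ?_ hT hI
    rintro I (rfl | hI)
    · exact ⟨hxor, e3 n8 n10 n17⟩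
    · exact hN I hI
  · right
    rw [hset]
    refine fun I hI => indep_iff_of_triplewise hrk hpar' hloop hN ?_ hI
    simp only [List.triplewise_cons, List.pairwise_cons, List.forall_mem_cons,
      List.not_mem_nil, IsEmpty.forall_iff, implies_true, and_true, List.Pairwise.nil,
      List.Triplewise.nil]
    simp [*, nonFanoLines]

end Quadrangle

/-! ### Conjugates from quadrangles in a harmonic matroid -/

section Harmonic

variable {α : Type u} {M : Matroid α} {y x z o q r s o' q' r' s' t e : α}

theorem Quad.not_par_base (h : Quad M y x z o q r s) : ¬ Par M y z := fun hp =>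
  not_col_of_diagonal h.hy h.yoq h.yrs.swap_right h.oqs (fun h' => h.ors h'.swap_right)
    (hp.symm.col_of_col h.hz h.zos)

theorem Quad.not_par_side (h : Quad M y x z o q r s) : ¬ Par M o r := not_par_of_not_col h.ors

/-- The harmonic conjugate of a quadrangle in a harmonic matroid. -/
theorem IsHarmonic.exists_point (hM : IsHarmonic M) (h : Quad M y x z o q r s) :
    ∃ x' ∈ M.E, HC M y z x x' ∧ Col M y z x' ∧ Col M o r x' ∧
      ∀ t ∈ M.E, Col M y z t → Col M o r t → t = x' := by
  obtain ⟨x', hx'⟩ := hM.exists_conj _ _ _ _ _ _ _ h.hp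
  have hmem : x' ∈ M.closure {y, z} ∩ M.closure {o, r} := hx' ▸ rfl
  refine ⟨x', M.closure_subset_ground _ hmem.1, ⟨o, q, r, s, h.hp, hx'⟩,
    col_of_mem_closure hmem.1, col_of_mem_closure hmem.2, fun t ht h1 h2 => ?_⟩
  have : t ∈ M.closure {y, z} ∩ M.closure {o, r} :=
    ⟨h1.mem_closure h.not_par_base ht, h2.mem_closure h.not_par_side ht⟩
  rwa [hx'] at this

theorem Quad.hc (hM : IsHarmonic M) (h : Quad M y x z o q r s) (ht : t ∈ M.E)
    (h₁ : Col M y z t) (h₂ : Col M o r t) : HC M y z x t := by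
  obtain ⟨x', -, hc, -, -, huniq⟩ := hM.exists_point h
  rwa [huniq t ht h₁ h₂]

/-- The harmonic conjugate does not depend on the quadrangle. -/
theorem IsHarmonic.col_of_quad (hM : IsHarmonic M) (h : Quad M y x z o q r s)
    (h' : Quad M y x z o' q' r' s') (ht : t ∈ M.E) (h₁ : Col M y z t) (h₂ : Col M o r t) :
    Col M o' r' t := by
  obtain ⟨x', -, hc, -, h3, -⟩ := hM.exists_point h'
  rwa [hM.unique_conj _ _ _ _ _ (h.hc hM ht h₁ h₂) hc]

theorem col_of_isLoop (he : M.IsLoop e) (a b : α) : Col M a b e := by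
  have h1 : Par M a e := by
    rw [Par, pair_comm]
    refine (M.eRk_union_le_eRk_add_eRk {e} {a}).trans ?_
    rw [he.eRk_eq, zero_add]
    exact M.eRk_singleton_le a
  exact (h1.col b).swap_right

end Harmonic

/-! ### Three concurrent lines and the line of conjugates -/

section Fibres

variable {α : Type u} {M : Matroid α} {p : ℕ} {D : α} {U V W : ZMod p → α}

/-- Three concurrent lines through `D` with the incidences of `L_p`: three points of different
lines are collinear when their indices add up to zero. -/
structure Conf (M : Matroid α) (D : α) (U V W : ZMod p → α) : Prop where
  colU : ∀ i j, Col M D (U i) (U j)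
  colV : ∀ i j, Col M D (V i) (V j)
  colW : ∀ i j, Col M D (W i) (W j)
  col : ∀ i j k, i + j + k = 0 → Col M (U i) (V j) (W k)
  ncUV : ∀ i j, ¬ Col M D (U i) (V j)
  ncVW : ∀ i j, ¬ Col M D (V i) (W j)
  ncUW : ∀ i j, ¬ Col M D (U i) (W j)
  parU : ∀ i j, i ≠ j → ¬ Par M (U i) (U j)
  parV : ∀ i j, i ≠ j → ¬ Par M (V i) (V j)
  parW : ∀ i j, i ≠ j → ¬ Par M (W i) (W j)

theorem Conf.swap (h : Conf M D U V W) : Conf M D V U W where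
  colU := h.colV
  colV := h.colU
  colW := h.colW
  col i j k hs := (h.col j i k (by rw [← hs]; ring)).swap
  ncUV i j hc := h.ncUV j i hc.swap_right
  ncVW := h.ncUW
  ncUW := h.ncVW
  parU := h.parV
  parV := h.parU
  parW := h.parW

theorem Conf.rotate (h : Conf M D U V W) : Conf M D V W U where
  colU := h.colV
  colV := h.colW
  colW := h.colU
  col i j k hs := (h.col k i j (by rw [← hs]; ring)).rotate
  ncUV := h.ncVW
  ncVW i j hc := h.ncUW j i hc.swap_right
  ncUW i j hc := h.ncUV j i hc.swap_right
  parU := h.parV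
  parV := h.parW
  parW := h.parU

theorem Conf.nonloopU (h : Conf M D U V W) (i : ZMod p) : M.IsNonloop (U i) :=
  isNonloop_right_of_not_par (not_par_of_not_col (h.ncUV i 0))

theorem Conf.nonloopV (h : Conf M D U V W) (i : ZMod p) : M.IsNonloop (V i) := h.swap.nonloopU i

theorem Conf.nonloopW (h : Conf M D U V W) (i : ZMod p) : M.IsNonloop (W i) :=
  h.rotate.nonloopV i

theorem Conf.nonloopD (h : Conf M D U V W) : M.IsNonloop D :=
  isNonloop_left_of_not_par (not_par_of_not_col (h.ncUV 0 0))

theorem Conf.colUUU (h : Conf M D U V W) (i j k : ZMod p) : Col M (U i) (U j) (U k) :=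
  Col.trans₃ (not_par_of_not_col (h.ncUV i 0)) (h.colU i i) (h.colU i j) (h.colU i k)

theorem Conf.colVVV (h : Conf M D U V W) (i j k : ZMod p) : Col M (V i) (V j) (V k) :=
  h.swap.colUUU i j k

theorem Conf.ncUUV (h : Conf M D U V W) {i j : ZMod p} (hij : i ≠ j) (k : ZMod p) :
    ¬ Col M (U i) (U j) (V k) := fun hc =>
  h.ncUV i k (Col.trans (h.parU i j hij) (h.colU i j).rotate hc).swap

theorem Conf.ncVVW (h : Conf M D U V W) {i j : ZMod p} (hij : i ≠ j) (k : ZMod p) :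
    ¬ Col M (V i) (V j) (W k) := h.rotate.ncUUV hij k

theorem Conf.ncWWV (h : Conf M D U V W) {i j : ZMod p} (hij : i ≠ j) (k : ZMod p) :
    ¬ Col M (W i) (W j) (V k) := h.rotate.swap.ncUUV hij k

theorem Conf.ncWWU (h : Conf M D U V W) {i j : ZMod p} (hij : i ≠ j) (k : ZMod p) :
    ¬ Col M (W i) (W j) (U k) := h.rotate.rotate.ncUUV hij k

/-- The line through `U i` and `V j` meets `W` in `W (-(i + j))`. A second point of `W` on it would
put `U i` on the line `W`. -/
theorem Conf.not_col (h : Conf M D U V W) {i j k : ZMod p} (hs : i + j + k ≠ 0) :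
    ¬ Col M (U i) (V j) (W k) := fun hc => by
  have hne : k ≠ -(i + j) := fun hk => hs (by rw [hk]; ring)
  have h1 := h.col i j (-(i + j)) (by ring)
  have hp : ¬ Par M (U i) (V j) := fun hp => h.ncUV i j (hp.col D).rotate.rotate
  exact h.ncWWU hne i (Col.trans hp hc h1).rotate

/-- A harmonic matroid that contains `L_p` has no loops. -/
theorem Conf.isNonloop [Fact p.Prime] (hM : IsHarmonic M) (h : Conf M D U V W) {e : α}
    (he : e ∈ M.E) : M.IsNonloop e := by
  by_contra hl
  replace hl : M.IsLoop e := (Matroid.not_isNonloop_iff he).1 hl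
  have h01 : (0 : ZMod p) ≠ 1 := zero_ne_one
  -- A loop lies in every closure, so it would be the single common point of the two lines of this
  -- quadrangle; but that point is `U 0`.
  have hQ : Quad M D (U (-2)) (U (-1)) (V 0) (V 1) (W 0) (W 1) := {
    oqr := h.ncVVW h01 0
    oqs := h.ncVVW h01 1
    ors := fun hc => h.ncWWV h01 0 hc.rotate
    qrs := fun hc => h.ncWWV h01 1 hc.rotate
    yoq := h.colV 0 1
    yrs := h.colW 0 1
    zos := h.col _ _ _ (by ring)
    zqr := h.col _ _ _ (by ring)
    xqs := h.col _ _ _ (by ring)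
    yxz := h.colU _ _
    hy := h.nonloopD
    hx := h.nonloopU _
    hz := h.nonloopU _ }
  obtain ⟨x', -, -, -, -, huniq⟩ := hM.exists_point hQ
  have h1 := huniq e he (col_of_isLoop hl _ _) (col_of_isLoop hl _ _)
  have h2 := huniq (U 0) (h.nonloopU 0).mem_ground (h.colU _ _)
    (h.col 0 0 0 (by ring)).rotate
  exact (h.nonloopU 0).not_isLoop (by rwa [h2, ← h1])

/-- The quadrangles that define the conjugate of a point of the line `U`. -/
theorem Conf.quad_conj (h : Conf M D U V W) (j k : ZMod p) {t : ZMod p} (ht : t ≠ 0) :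
    Quad M (V j) (U (-j - k)) (W k) (V (j - t)) D (W (k - t)) (U (-j - k + t)) where
  oqr hc := h.ncVW _ _ hc.swap
  oqs hc := h.ncUV _ _ hc.rotate
  ors hc := h.not_col (i := -j - k + t) (j := j - t) (k := k - t)
    (by ring_nf; simpa using ht) hc.rotate.rotate
  qrs hc := h.ncUW _ _ hc.swap_right
  yoq := (h.colV _ _).rotate
  yrs := (h.col _ _ _ (by ring)).rotate
  zos := (h.col _ _ _ (by ring)).swap.swap_right.swap
  zqr := (h.colW _ _).rotate.rotate
  xqs := (h.colU _ _).swap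
  yxz := (h.col _ _ _ (by ring)).swap
  hy := h.nonloopV _
  hx := h.nonloopU _
  hz := h.nonloopW _

/-- `T` is the line of conjugates of the points of `U` with respect to those of `V` and `W`. -/
structure IsConjLine (M : Matroid α) (U V W T : ZMod p → α) : Prop where
  nonloop : ∀ m, M.IsNonloop (T m)
  hc : ∀ m, HC M (V m) (W 0) (U (-m)) (T m)
  col : ∀ m k, Col M (V (m + k)) (W k) (T m)

/-- For fixed `m` the quadrangles `quad_conj m 0` with `t ≠ 0` share the base `V m`, `U (-m)`, `W
0`, and their side `or` is the line through `V (m - t)` and `W (-t)`. By harmonicity all these sides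
pass through one point of the base line. -/
theorem Conf.exists_conjLine [Fact p.Prime] (hM : IsHarmonic M) (h : Conf M D U V W) :
    ∃ T : ZMod p → α, IsConjLine M U V W T := by
  have key : ∀ m : ZMod p, ∃ t, M.IsNonloop t ∧ HC M (V m) (W 0) (U (-m)) t ∧
      ∀ k, Col M (V (m + k)) (W k) t := by
    intro m
    have hQ : ∀ {t : ZMod p}, t ≠ 0 →
        Quad M (V m) (U (-m)) (W 0) (V (m - t)) D (W (-t)) (U (-m + t)) := by
      intro t ht
      simpa using h.quad_conj m 0 ht
    obtain ⟨t, htE, hc, h1, h2, -⟩ := hM.exists_point (hQ one_ne_zero)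
    refine ⟨t, h.isNonloop hM htE, hc, fun k => ?_⟩
    by_cases hk : k = 0
    · simpa [hk] using h1
    -- Compare the quadrangle for `t = 1`, which defines the conjugate, with that for `t = -k`.
    · simpa using hM.col_of_quad (hQ one_ne_zero) (hQ (neg_ne_zero.2 hk)) htE h1 h2
  choose T hT1 hT2 hT3 using key
  exact ⟨T, hT1, hT2, hT3⟩

variable {T : ZMod p → α}

/-- Otherwise `U (-c)` would lie on the line through `V (c + 1)` and `W 1`, where the indices add up
to 2. For `p = 2` this does happen, as in the Fano plane. -/
theorem Conf.not_par_conj (h : Conf M D U V W) (hT : IsConjLine M U V W T)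
    (h2 : (2 : ZMod p) ≠ 0) (c : ZMod p) : ¬ Par M (T c) (U (-c)) := fun hp => by
  have h1 := hp.col_of_col (hT.nonloop c) (hT.col c 1).rotate.rotate
  exact h.not_col (i := -c) (j := c + 1) (k := 1) (by ring_nf; simpa using h2) h1

theorem Conf.not_parV_conj [Fact p.Prime] (h : Conf M D U V W) (hT : IsConjLine M U V W T)
    (m k : ZMod p) : ¬ Par M (T m) (V k) := fun hp => by
  -- The line through `T m` and `V (k + 1)` has its point of `W` at index `k - m + 1`; it would
  -- contain two points of `V`.
  have h1 := hp.col_of_col (hT.nonloop m) (hT.col m (k - m + 1)).rotate.rotate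
  refine h.ncVVW (i := k) (j := m + (k - m + 1)) ?_ _ h1
  ring_nf
  simp

theorem Conf.not_parW_conj [Fact p.Prime] (h : Conf M D U V W) (hT : IsConjLine M U V W T)
    (m k : ZMod p) : ¬ Par M (T m) (W k) := fun hp => by
  have h1 := hp.col_of_col (hT.nonloop m) (hT.col m (k + 1)).rotate.rotate
  refine h.ncWWV (i := k) (j := k + 1) (by simp) _ h1.swap_right

theorem Conf.not_colV_conj [Fact p.Prime] (h : Conf M D U V W) (hT : IsConjLine M U V W T)
    (m k : ZMod p) : ¬ Col M D (V k) (T m) := fun hc => by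
  have h1 := hT.col m (k - m)
  rw [add_sub_cancel] at h1
  exact h.ncVW _ _ (Col.trans (fun h' => h.not_parV_conj hT m k h'.symm)
    hc.rotate h1.swap_right).swap

theorem Conf.not_colW_conj [Fact p.Prime] (h : Conf M D U V W) (hT : IsConjLine M U V W T)
    (m k : ZMod p) : ¬ Col M D (W k) (T m) := fun hc =>
  h.ncVW _ _ (Col.trans (fun h' => h.not_parW_conj hT m k h'.symm) hc.rotate
    (hT.col m k).rotate).swap.swap_right

/-- Harmonic position of the centre on the line `V`. -/
theorem Conf.exists_quad_center [Fact p.Prime] (h : Conf M D U V W)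
    (hT : IsConjLine M U V W T) (h2 : (2 : ZMod p) ≠ 0) (c : ZMod p) {d : ZMod p} (hd : d ≠ 0) :
    ∃ o q r s, Quad M (V (c + d)) (V c) (V (c - d)) o q r s ∧ Col M o r D := by
  have hdd : -d ≠ d := fun h' => hd ((mul_eq_zero.1
    (show 2 * d = 0 by linear_combination -h')).resolve_left h2)
  have hline : Col M (U (-c)) (V c) (T c) ∧ Col M (U (-c)) (V c) (W 0) ∧
      Col M (V c) (W 0) (T c) := by
    have h1 : Col M (U (-c)) (V c) (W 0) := h.col _ _ _ (by ring)
    have h3 : Col M (V c) (W 0) (T c) := by simpa using hT.col c 0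
    have hp : ¬ Par M (V c) (W 0) := fun hp => h.ncVW c 0 (hp.col D).rotate.rotate
    exact ⟨(Col.trans hp h1.rotate h3).swap, h1, h3⟩
  obtain ⟨hl1, hl2, hl3⟩ := hline
  have hpTU := h.not_par_conj hT h2 c
  have hUT : Col M (U (-c)) (T c) (W 0) :=
    Col.trans (fun hp => h.ncUV (-c) c (hp.col D).rotate.rotate) hl1 hl2
  have hnc : ∀ {k : ZMod p}, k ≠ 0 → ¬ Col M (U (-c)) (T c) (W k) := fun hk hc =>
    h.ncWWU hk _ (Col.trans (fun hp => hpTU hp.symm) hc hUT).rotate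
  have hncT : ¬ Col M (W (-d)) (W d) (T c) := fun hc =>
    h.not_colW_conj hT c (-d) (Col.trans (h.parW _ _ hdd) (h.colW _ _).rotate hc).swap
  -- The side `or` lies on the line `W`, hence passes through `D`. So `D` is the conjugate of the
  -- midpoint `V c` with respect to `V (c + d)` and `V (c - d)`.
  refine ⟨W (-d), U (-c), W d, T c, ?_, (h.colW _ _).rotate⟩
  exact {
    oqr := fun hc => h.ncWWU hdd _ hc.swap_right
    oqs := fun hc => hnc (neg_ne_zero.2 hd) hc.rotate
    ors := hncT
    qrs := fun hc => hnc hd hc.swap_right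
    yoq := (h.col _ _ _ (by ring)).rotate
    yrs := hT.col c d
    zos := by simpa [sub_eq_add_neg] using hT.col c (-d)
    zqr := (h.col _ _ _ (by ring)).swap
    xqs := hl1.swap
    yxz := h.colVVV _ _ _
    hy := h.nonloopV _
    hx := h.nonloopV _
    hz := h.nonloopV _ }

theorem Conf.not_col_conj_VW [Fact p.Prime] (h : Conf M D U V W) (hT : IsConjLine M U V W T)
    {m j k : ZMod p} (hne : j ≠ m + k) : ¬ Col M (T m) (V j) (W k) := fun hc =>
  h.ncVVW hne k (Col.trans (fun hp => h.not_parW_conj hT m k hp.symm) hc.rotate.rotate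
    (hT.col m k).rotate).rotate

/-- The centre is collinear with the conjugates. -/
theorem Conf.col_conj [Fact p.Prime] (hM : IsHarmonic M) (h : Conf M D U V W)
    (hT : IsConjLine M U V W T) (h2 : (2 : ZMod p) ≠ 0) (m n : ZMod p) :
    Col M D (T m) (T n) := by
  by_cases hmn : m = n
  · rw [hmn]
    exact col_right M D (T n)
  -- Midpoint and half-difference of the two indices; `p` is odd.
  obtain ⟨c, d, hd, rfl, rfl⟩ : ∃ c d : ZMod p, d ≠ 0 ∧ m = c + d ∧ n = c - d := by
    refine ⟨(m + n) / 2, (m - n) / 2, div_ne_zero (sub_ne_zero.2 hmn) h2, ?_, ?_⟩ <;>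
      field_simp <;> ring
  -- With `U` and `V` exchanged, the auxiliary conjugates `S` show that `D` is the conjugate of `U
  -- c` with respect to `U (c + d)` and `U (c - d)`.
  obtain ⟨S, hS⟩ := h.swap.exists_conjLine hM
  obtain ⟨o, q, r, s, hQ, hor⟩ := h.swap.exists_quad_center hS h2 c hd
  have hdd : d ≠ -d := fun h' => hd ((mul_eq_zero.1
    (show 2 * d = 0 by linear_combination h')).resolve_left h2)
  have hU : ∀ e, Col M (U e) (T e) (V 0) := by
    intro e
    have h1 := hT.col e (-e)
    rw [add_neg_cancel] at h1
    exact Col.trans₃ (fun hp => h.ncVW _ _ (hp.col D).rotate.rotate)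
      (h.col e 0 (-e) (by ring)).rotate h1 (col_left M _ _)
  have hUW : ∀ e f, c + d = e ∧ c - d = f ∨ c - d = e ∧ c + d = f →
      Col M (U e) (T f) (W (-c)) := by
    intro e f hef
    have hs : e + f = 2 * c := by
      rcases hef with ⟨rfl, rfl⟩ | ⟨rfl, rfl⟩ <;> ring
    exact Col.trans₃ (fun hp => h.ncVW _ _ (hp.col D).rotate.rotate)
      (h.col e (f + -c) (-c) (by linear_combination hs)).rotate (hT.col f (-c))
      (col_right M _ _)
  have hTV : ∀ e, Col M (T e) (V 0) (W (-e)) := by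
    intro e
    have h1 := hT.col e (-e)
    rw [add_neg_cancel] at h1
    exact h1.rotate.rotate
  -- A second quadrangle on the same three points of `U`, now with the line through `T (c + d)` and
  -- `T (c - d)` as the side `or`, which must therefore contain `D`.
  have hQ' : Quad M (U (c + d)) (U c) (U (c - d)) (T (c + d)) (V 0) (T (c - d)) (W (-c)) := {
    oqr := fun hc => not_col_of_two_lines (hTV _) (hTV _)
      (fun hc' => h.ncWWV (fun h' => hdd (by linear_combination -h')) 0 hc'.rotate)
      (h.not_parV_conj hT _ _) (h.not_parV_conj hT _ _) hc.swap_right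
    oqs := h.not_col_conj_VW hT fun h' => hd (by linear_combination -h')
    ors := not_col_of_two_lines (hT.col _ (-c)).rotate.rotate.swap_right
      (hT.col _ (-c)).rotate.rotate.swap_right
      (fun hc' => h.ncVVW (fun h' => hdd (by linear_combination h')) _ hc'.rotate)
      (h.not_parW_conj hT _ _) (h.not_parW_conj hT _ _)
    qrs := fun hc => h.not_col_conj_VW hT (fun h' => hd (by linear_combination h')) hc.swap
    yoq := hU _
    yrs := hUW _ _ (Or.inl ⟨rfl, rfl⟩)
    zos := hUW _ _ (Or.inr ⟨rfl, rfl⟩)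
    zqr := (hU _).swap_right
    xqs := h.col _ _ _ (by ring)
    yxz := h.colUUU _ _ _
    hy := h.nonloopU _
    hx := h.nonloopU _
    hz := h.nonloopU _ }
  exact (hM.col_of_quad hQ hQ' h.nonloopD.mem_ground (h.colU _ _).rotate hor).rotate.rotate

/-- The lines `V`, `T` and `W` have again the incidences of `L_p`. -/
theorem Conf.next [Fact p.Prime] (hM : IsHarmonic M) (h : Conf M D U V W)
    (hT : IsConjLine M U V W T) (h2 : (2 : ZMod p) ≠ 0) :
    Conf M D (fun i => V (-i)) T W where
  colU i j := h.colV _ _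
  colV := h.col_conj hM hT h2
  colW := h.colW
  col i j k hs := by
    have h1 := hT.col j k
    rw [show j + k = -i by linear_combination hs] at h1
    exact h1.swap_right
  ncUV i j := h.not_colV_conj hT j _
  ncVW i j hc := h.not_colW_conj hT i j hc.swap_right
  ncUW i j := h.ncVW _ _
  parU i j hij := h.parV _ _ fun h' => hij (neg_injective h')
  parV i j hij hp := by
    have h1 := hp.col_of_col (hT.nonloop i) (hT.col i 0).rotate.rotate
    exact h.not_col_conj_VW hT (fun h' => hij (by simpa using h')) h1
  parW := h.parW

end Fibres

/-! ### Closure properties of iterated conjugation -/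

section HarmonicClosure

variable {α : Type u} {M : Matroid α} {S : Set α} {a b c x : α}

theorem subset_harmonicStep (M : Matroid α) (S : Set α) : S ⊆ harmonicStep M S :=
  subset_union_left

theorem monotone_iterate_harmonicStep (M : Matroid α) (S : Set α) :
    Monotone fun n : ℕ => (harmonicStep M)^[n] S :=
  monotone_nat_of_le_succ fun n => by
    simp only [Function.iterate_succ_apply']
    exact subset_harmonicStep M _

theorem subset_harmonicClosure (M : Matroid α) (S : Set α) : S ⊆ harmonicClosure M S :=
  fun _ hx => mem_iUnion.2 ⟨0, hx⟩

theorem mem_harmonicClosure_of_hc (hx : x ∈ M.E) (ha : a ∈ harmonicClosure M S)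
    (hb : b ∈ harmonicClosure M S) (hc : c ∈ harmonicClosure M S) (h : HC M a c b x) :
    x ∈ harmonicClosure M S := by
  obtain ⟨i, hi⟩ := mem_iUnion.1 ha
  obtain ⟨j, hj⟩ := mem_iUnion.1 hb
  obtain ⟨k, hk⟩ := mem_iUnion.1 hc
  have hmono := monotone_iterate_harmonicStep M S
  refine mem_iUnion.2 ⟨max i (max j k) + 1, ?_⟩
  rw [Function.iterate_succ_apply']
  exact Or.inr ⟨hx, a, hmono (le_max_left _ _) hi,
    b, hmono ((le_max_left j k).trans (le_max_right _ _)) hj,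
    c, hmono ((le_max_right j k).trans (le_max_right _ _)) hk, h⟩

theorem harmonicClosure_subset {X : Set α} (hS : S ⊆ X)
    (hX : ∀ a ∈ X, ∀ b ∈ X, ∀ c ∈ X, ∀ x, HC M a c b x → x ∈ X) : harmonicClosure M S ⊆ X := by
  refine iUnion_subset fun n => ?_
  induction n with
  | zero => exact hS
  | succ n ih =>
    rw [Function.iterate_succ_apply']
    rintro x (hx | ⟨-, a, ha, b, hb, c, hc, h⟩)
    · exact ih hx
    · exact hX a (ih ha) b (ih hb) c (ih hc) x h

end HarmonicClosure

/-! ### Iterating the reflection to an affine plane -/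

section Sequence

variable {α : Type u} {M : Matroid α} {p : ℕ} [Fact p.Prime] {D : α} {U V W : ZMod p → α}

/-- `P k i` is to be the point `(k, i)`. `Conf` wants the second line with negated indices, hence
the signs: `P (k + 2) (-m)` is the reflection of `P k (-m)` in `P (k + 1) (-m)`. -/
theorem Conf.exists_seq_of_odd (hM : IsHarmonic M) (h : Conf M D U V W)
    (h2 : (2 : ZMod p) ≠ 0) :
    ∃ P : ℕ → ZMod p → α, P 0 = U ∧ (P 1 = fun i => V (-i)) ∧
      (∀ k, Conf M D (P k) (fun j => P (k + 1) (-j)) W) ∧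
      ∀ k, IsConjLine M (P k) (fun j => P (k + 1) (-j)) W (fun m => P (k + 2) (-m)) := by
  -- The recursion needs two consecutive lines and the proof that they form a `Conf` with `W`.
  let St := {Q : (ZMod p → α) × (ZMod p → α) // Conf M D Q.1 Q.2 W}
  have hex : ∀ Q : St, ∃ T, IsConjLine M Q.1.1 Q.1.2 W T := fun Q => Q.2.exists_conjLine hM
  choose T hT using hex
  let step : St → St := fun Q =>
    ⟨(fun i => Q.1.2 (-i), T Q), Q.2.next hM (hT Q) h2⟩
  let R : ℕ → St := fun n => step^[n] ⟨(U, V), h⟩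
  have hR : ∀ n, R (n + 1) = step (R n) := fun n => Function.iterate_succ_apply' _ _ _
  have hV : ∀ k, (fun j => (R (k + 1)).1.1 (-j)) = (R k).1.2 := by
    intro k
    funext j
    rw [hR]
    exact congrArg _ (neg_neg j)
  have hT' : ∀ k, (fun m => (R (k + 2)).1.1 (-m)) = T (R k) := by
    intro k
    rw [hV (k + 1), hR]
  refine ⟨fun n => (R n).1.1, rfl, ?_, fun k => ?_, fun k => ?_⟩
  · change (R (0 + 1)).1.1 = _
    rw [hR]
    rfl
  · simp only [hV]
    exact (R k).2
  · change IsConjLine M (R k).1.1 (fun j => (R (k + 1)).1.1 (-j)) W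
      (fun m => (R (k + 2)).1.1 (-m))
    rw [hT', hV]
    exact hT _

/-- The sequence of lines through the centre that is generated by harmonic conjugation. -/
theorem Conf.exists_seq (hM : IsHarmonic M) (h : Conf M D U V W) :
    ∃ P : ℕ → ZMod p → α, P 0 = U ∧ (P 1 = fun i => V (-i)) ∧
      (∀ k, k + 1 < p → Conf M D (P k) (fun j => P (k + 1) (-j)) W) ∧
      ∀ k, k + 2 < p →
        IsConjLine M (P k) (fun j => P (k + 1) (-j)) W (fun m => P (k + 2) (-m)) := by
  by_cases hp : p = 2
  -- For `p = 2` the two given lines are all that is required: no `k` satisfies `k + 2 < p`.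
  · refine ⟨fun k => if k = 0 then U else fun i => V (-i), rfl, rfl, fun k hk => ?_,
      fun k hk => by omega⟩
    obtain rfl : k = 0 := by omega
    simpa using h
  · have h2 : (2 : ZMod p) ≠ 0 := by
      have : Fact (2 < p) := ⟨(Fact.out : p.Prime).two_le.lt_of_ne' hp⟩
      intro h2
      exact ZMod.neg_one_ne_one (n := p) (by linear_combination -h2)
    obtain ⟨P, h0, h1, hC, hT⟩ := h.exists_seq_of_odd hM h2
    exact ⟨P, h0, h1, fun k _ => hC k, fun k _ => hT k⟩

/-- The incidences of the affine plane of order `p`: `X k i` is the point with coordinates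
`(k, i)`, the point at infinity of the lines of slope `s` is `W s`, and that of the lines with
constant first coordinate is `D`. -/
structure AffineConf (M : Matroid α) (D : α) (X : ZMod p → ZMod p → α) (W : ZMod p → α) :
    Prop where
  colX : ∀ k i j, Col M D (X k i) (X k j)
  colW : ∀ i j, Col M D (W i) (W j)
  col : ∀ i s k, Col M (X 0 i) (W s) (X k (i + k * s))
  ncXW : ∀ k i s, ¬ Col M D (X k i) (W s)
  ncXX : ∀ k l i j, k ≠ l → ¬ Col M D (X k i) (X l j)
  parX : ∀ k i j, i ≠ j → ¬ Par M (X k i) (X k j)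
  parW : ∀ i j, i ≠ j → ¬ Par M (W i) (W j)

/-- Neighbouring lines are related by `Conf`; induction on `k` transports a line of slope `s` from
`x = 0` to `x = k`. That non-neighbouring lines are distinct is not built in and needs an argument.
-/
theorem Conf.exists_affineConf (hM : IsHarmonic M) (h : Conf M D U V W) {S : Set α}
    (hU : ∀ i, U i ∈ harmonicClosure M S) (hV : ∀ i, V i ∈ harmonicClosure M S)
    (hW : ∀ i, W i ∈ harmonicClosure M S) :
    ∃ X : ZMod p → ZMod p → α, AffineConf M D X W ∧ X 0 = U ∧ (X 1 = fun i => V (-i)) ∧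
      ∀ k i, X k i ∈ harmonicClosure M S := by
  obtain ⟨P, h0, h1, hC, hT⟩ := h.exists_seq hM
  have hp1 : 1 < p := (Fact.out : p.Prime).one_lt
  have hcolX : ∀ k < p, ∀ i j, Col M D (P k i) (P k j) := by
    rintro (_ | k) hk i j
    · exact (hC 0 hp1).colU i j
    · simpa using (hC k hk).colV (-i) (-j)
  have hncXW : ∀ k < p, ∀ i s, ¬ Col M D (P k i) (W s) := by
    rintro (_ | k) hk i s
    · exact (hC 0 hp1).ncUW i s
    · simpa using (hC k hk).ncVW (-i) s
  have hparX : ∀ k < p, ∀ i j, i ≠ j → ¬ Par M (P k i) (P k j) := by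
    rintro (_ | k) hk i j hij
    · exact (hC 0 hp1).parU i j hij
    · simpa using (hC k hk).parV (-i) (-j) (by simpa using hij)
  have hpXW : ∀ k < p, ∀ i s, ¬ Par M (P k i) (W s) := fun k hk i s hp =>
    hncXW k hk i s (hp.col D).rotate.rotate
  have hpDX : ∀ k < p, ∀ i, ¬ Par M D (P k i) := fun k hk i =>
    not_par_of_not_col (hncXW k hk i 0)
  have hcol : ∀ k < p, ∀ i s, Col M (P 0 i) (W s) (P k (i + k * s)) := by
    intro k
    induction k with
    | zero =>
      intro _ i s
      simpa using col_left M (P 0 i) (W s)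
    | succ k ih =>
      intro hk i s
      have hk' : k < p := by omega
      have h3 : Col M (P k (i + k * s)) (P (k + 1) (i + (k + 1 : ℕ) * s)) (W s) := by
        have h4 := (hC k hk).col (i + k * s) (-(i + (k + 1 : ℕ) * s)) s (by push_cast; ring)
        simpa only [neg_neg] using h4
      exact Col.trans₃ (hpXW k hk' (i + k * s) s) (ih hk' i s).rotate.rotate.swap_right
        (col_right M _ _) h3.swap_right
  have hncXX : ∀ k < p, ∀ l < p, ∀ i j, k ≠ l → ¬ Col M D (P k i) (P l j) := by
    intro k hk l hl i j hkl hc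
    have hall : ∀ i' j', Col M D (P k i') (P l j') := by
      intro i' j'
      have h3 := Col.trans (hpDX k hk i) (hcolX k hk i i') hc |>.swap_right
      exact (Col.trans (hpDX l hl j) h3 (hcolX l hl j j'))
    -- Suppose the lines `k` and `l` coincide. The line of slope `s` through `P k 0` meets the
    -- common line only once, as `W s` is not on it, so its point on line `l` is parallel to `P k
    -- 0`. The slopes 0 and 1 then give two parallel points with different indices on line `l`.
    have hpar : ∀ s, Par M (P k 0) (P l (((l : ZMod p) - k) * s)) := by
      intro s
      by_contra hp
      have h3 := hcol k hk (-(k * s)) s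
      have h4 := hcol l hl (-(k * s)) s
      rw [neg_add_cancel] at h3
      rw [show -((k : ZMod p) * s) + l * s = (l - k) * s by ring] at h4
      have h5 := Col.trans₃ (hpXW 0 (by omega) _ _) h3 h4 (col_right M _ _)
      exact hncXW k hk 0 s (Col.trans hp (hall 0 _).rotate h5).swap
    have h3 := (hpar 0).symm.trans
      (isNonloop_right_of_not_par (hpDX k hk 0)) (hpar 1)
    refine hparX l hl _ _ ?_ h3
    rw [mul_zero, mul_one]
    intro h4
    have h5 : (l : ZMod p) = k := (sub_eq_zero.1 h4.symm)
    rw [ZMod.natCast_eq_natCast_iff', Nat.mod_eq_of_lt hl, Nat.mod_eq_of_lt hk] at h5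
    exact hkl h5.symm
  have hmem : ∀ k < p, ∀ i, P k i ∈ harmonicClosure M S := by
    intro k
    induction k using Nat.strong_induction_on with
    | _ k ih =>
      match k, ih with
      | 0, _ => exact fun _ i => h0 ▸ hU i
      | 1, _ => exact fun _ i => by rw [h1]; exact hV _
      | k + 2, ih =>
        intro hk i
        have h3 := (hT k hk).hc (-i)
        have h4 := (hT k hk).nonloop (-i)
        simp only [neg_neg] at h3 h4
        exact mem_harmonicClosure_of_hc h4.mem_ground (ih (k + 1) (by omega) (by omega) _)
          (ih k (by omega) (by omega) _) (hW _) h3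
  -- Coordinates in `ZMod p` are represented by their values below `p`, so no periodicity of the
  -- sequence `P` is required.
  refine ⟨fun k => P k.val, ?_, ?_, ?_, fun k i => hmem _ k.val_lt i⟩
  · exact {
      colX := fun k => hcolX _ k.val_lt
      colW := h.colW
      col := fun i s k => by
        simpa using hcol k.val k.val_lt i s
      ncXW := fun k => hncXW _ k.val_lt
      ncXX := fun k l i j hkl => hncXX _ k.val_lt _ l.val_lt i j
        fun h' => hkl (ZMod.val_injective p h')
      parX := fun k => hparX _ k.val_lt
      parW := h.parW }
  · simp [h0]
  · have : Fact (1 < p) := ⟨hp1⟩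
    simp [ZMod.val_one, h1]

end Sequence

/-! ### Transport of plane structure along isomorphisms -/

section Transfer

open Configuration

variable {P L P' L' : Type*} [Membership P L] [Membership P' L']

/-- Transport of the structure of a projective plane along an isomorphism. -/
noncomputable abbrev planeOfEquiv [ProjectivePlane P L] (e : P ≃ P') (g : L ≃ L')
    (h : ∀ x l, e x ∈ g l ↔ x ∈ l) : ProjectivePlane P' L' :=
  have h' : ∀ x l, x ∈ l ↔ e.symm x ∈ g.symm l := fun x l => by
    simpa using h (e.symm x) (g.symm l)
  { exists_point := fun l => by
      obtain ⟨x, hx⟩ := Nondegenerate.exists_point (P := P) (g.symm l)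
      exact ⟨e x, by simpa [h'] using hx⟩
    exists_line := fun x => by
      obtain ⟨l, hl⟩ := Nondegenerate.exists_line (L := L) (e.symm x)
      exact ⟨g l, by simpa [h'] using hl⟩
    eq_or_eq := fun {x₁ x₂ l₁ l₂} h₁ h₂ h₃ h₄ => by
      simp only [h'] at h₁ h₂ h₃ h₄
      simpa using Nondegenerate.eq_or_eq h₁ h₂ h₃ h₄
    mkPoint := fun {l₁ l₂} hl =>
      e (HasPoints.mkPoint (P := P) (fun hg => hl (g.symm.injective hg) : g.symm l₁ ≠ g.symm l₂))
    mkPoint_ax := fun {l₁ l₂} hl => by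
      simpa [h'] using HasPoints.mkPoint_ax (P := P)
        (fun hg => hl (g.symm.injective hg) : g.symm l₁ ≠ g.symm l₂)
    mkLine := fun {x₁ x₂} hx =>
      g (HasLines.mkLine (L := L) (fun hg => hx (e.symm.injective hg) : e.symm x₁ ≠ e.symm x₂))
    mkLine_ax := fun {x₁ x₂} hx => by
      simpa [h'] using HasLines.mkLine_ax (L := L)
        (fun hg => hx (e.symm.injective hg) : e.symm x₁ ≠ e.symm x₂)
    exists_config := by
      obtain ⟨x₁, x₂, x₃, l₁, l₂, l₃, hc⟩ := ProjectivePlane.exists_config (P := P) (L := L)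
      exact ⟨e x₁, e x₂, e x₃, g l₁, g l₂, g l₃, by simpa only [h] using hc⟩ }

theorem order_planeOfEquiv [ProjectivePlane P L] [Finite P] [Finite L] (e : P ≃ P') (g : L ≃ L')
    (h : ∀ x l, e x ∈ g l ↔ x ∈ l) :
    @ProjectivePlane.order P' L' _ (planeOfEquiv e g h) = ProjectivePlane.order P L := by
  let _ := planeOfEquiv e g h
  have : Finite P' := Finite.of_equiv P e
  have : Finite L' := Finite.of_equiv L g
  obtain ⟨x, -⟩ := ProjectivePlane.exists_config (P := P) (L := L)
  -- The order is one less than the number of lines through a point, and the isomorphism preserves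
  -- that number.
  have h1 := ProjectivePlane.lineCount_eq (L := L) x
  have h2 := ProjectivePlane.lineCount_eq (L := L') (e x)
  have h3 : lineCount L x = lineCount L' (e x) :=
    Nat.card_congr (g.subtypeEquiv fun l => (h x l).symm)
  omega

theorem Desarguesian.of_equiv (hD : Desarguesian P L) (e : P ≃ P') (g : L ≃ L')
    (h : ∀ x l, e x ∈ g l ↔ x ∈ l) : Desarguesian P' L' := by
  have hc : ∀ a b c : P, Collinear₃ L' (e a) (e b) (e c) ↔ Collinear₃ L a b c := by
    intro a b c
    simp only [Collinear₃, g.surjective.exists, h]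
  unfold Desarguesian
  simp only [e.surjective.forall, g.surjective.forall, h, hc, e.injective.ne_iff,
    g.injective.ne_iff]
  exact hD

end Transfer

/-! ### Images of projective planes in matroids -/

section PlaneMap

open Configuration

variable {α : Type u} {M : Matroid α} {P L : Type*} [Membership P L] {φ : P → α}

/-- A map from the points of an incidence structure to a matroid that preserves collinearity and
distinctness, and whose image has rank at least three. -/
structure PlaneMap (M : Matroid α) (L : Type*) [Membership P L] (φ : P → α) : Prop where
  col : ∀ (l : L) (u v w : P), u ∈ l → v ∈ l → w ∈ l → Col M (φ u) (φ v) (φ w)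
  par : ∀ u v, u ≠ v → ¬ Par M (φ u) (φ v)
  not_col : ∃ u v w, ¬ Col M (φ u) (φ v) (φ w)

theorem PlaneMap.injective (h : PlaneMap M L φ) : Function.Injective φ := fun u v huv => by
  by_contra hne
  exact ne_of_not_par (h.par u v hne) huv

theorem PlaneMap.exists_ne (h : PlaneMap M L φ) (u : P) : ∃ v, v ≠ u := by
  obtain ⟨a, b, c, hn⟩ := h.not_col
  have hab : a ≠ b := fun hab => ne_of_not_par (not_par_of_not_col hn) (congrArg φ hab)
  by_cases ha : a = u
  · exact ⟨b, fun hb => hab (ha.trans hb.symm)⟩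
  · exact ⟨a, ha⟩

theorem PlaneMap.nonloop (h : PlaneMap M L φ) (u : P) : M.IsNonloop (φ u) := by
  obtain ⟨v, hv⟩ := h.exists_ne u
  exact isNonloop_right_of_not_par (h.par v u hv)

theorem PlaneMap.range_subset (h : PlaneMap M L φ) : range φ ⊆ M.E := by
  rintro _ ⟨u, rfl⟩
  exact (h.nonloop u).mem_ground

theorem PlaneMap.indep_pair (h : PlaneMap M L φ) (u v : P) :
    (M.restrict (range φ)).Indep {φ u, φ v} := by
  refine Matroid.restrict_indep_iff.2 ⟨?_, by rintro _ (rfl | rfl) <;> exact mem_range_self _⟩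
  by_cases huv : u = v
  · simpa [huv] using h.nonloop v
  · exact indep_pair_of_not_par (h.par u v huv)

variable [ProjectivePlane P L]

theorem PlaneMap.exists_line (h : PlaneMap M L φ) (u v : P) : ∃ l : L, u ∈ l ∧ v ∈ l := by
  by_cases huv : u = v
  · obtain ⟨w, hw⟩ := h.exists_ne u
    have := HasLines.mkLine_ax (L := L) hw
    exact ⟨_, this.2, huv ▸ this.2⟩
  · exact ⟨_, HasLines.mkLine_ax huv⟩

/-- Collinearity is also reflected: if a triangle `u, v, w` had collinear images, then so would the
whole plane, because every point lies on a line joining `w` to a point of `uv`. This contradicts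
`not_col`. -/
theorem PlaneMap.col_iff (h : PlaneMap M L φ) {u v w : P} :
    Col M (φ u) (φ v) (φ w) ↔ Collinear₃ L u v w := by
  constructor
  · intro hc
    by_contra hn
    have huv : u ≠ v := by
      rintro rfl
      obtain ⟨l, hl⟩ := h.exists_line u w
      exact hn ⟨l, hl.1, hl.1, hl.2⟩
    obtain ⟨l, hul, hvl⟩ := h.exists_line u v
    have hwl : w ∉ l := fun hw => hn ⟨l, hul, hvl, hw⟩
    have hp := h.par u v huv
    have hall : ∀ t, Col M (φ u) (φ v) (φ t) := by
      intro t
      obtain ⟨m, htm, hwm⟩ := h.exists_line t w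
      have hml : m ≠ l := fun hml => hwl (hml ▸ hwm)
      obtain ⟨hsm, hsl⟩ := HasPoints.mkPoint_ax (P := P) hml
      set s : P := HasPoints.mkPoint hml
      have hsw : s ≠ w := fun hsw => hwl (hsw ▸ hsl)
      have h1 := h.col l u v s hul hvl hsl
      exact Col.trans₃ (h.par s w hsw) (Col.trans₃ hp h1 hc (col_left M _ _))
        (Col.trans₃ hp h1 hc (col_right M _ _)) (h.col m s w t hsm hwm htm)
    obtain ⟨a, b, c, hn'⟩ := h.not_col
    exact hn' (Col.trans₃ hp (hall a) (hall b) (hall c))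
  · rintro ⟨l, hu, hv, hw⟩
    exact h.col l u v w hu hv hw

theorem PlaneMap.closure_pair (h : PlaneMap M L φ) {u v : P} {l : L} (huv : u ≠ v) (hu : u ∈ l)
    (hv : v ∈ l) : (M.restrict (range φ)).closure {φ u, φ v} = φ '' {w | w ∈ l} := by
  have hp := h.par u v huv
  rw [Matroid.restrict_closure_eq _ (by rintro _ (rfl | rfl) <;> exact mem_range_self _)
    h.range_subset]
  ext x
  constructor
  · rintro ⟨hx, w, rfl⟩
    obtain ⟨m, hum, hvm, hwm⟩ := h.col_iff.1 (col_of_mem_closure hx)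
    rw [(Nondegenerate.eq_or_eq hum hvm hu hv).resolve_left huv] at hwm
    exact ⟨w, hwm, rfl⟩
  · rintro ⟨w, hw, rfl⟩
    exact ⟨(h.col l u v w hu hv hw).mem_closure hp (h.nonloop w).mem_ground, mem_range_self w⟩

theorem PlaneMap.eRank_eq (h : PlaneMap M L φ) : (M.restrict (range φ)).eRank = 3 := by
  rw [Matroid.eRank_restrict]
  obtain ⟨a, b, c, hn⟩ := h.not_col
  apply le_antisymm
  · have hsub : ({φ a, φ b, φ c} : Set α) ⊆ M.closure {φ a, φ b, φ c} :=
      M.subset_closure _ (by rintro _ (rfl | rfl | rfl) <;> exact (h.nonloop _).mem_ground)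
    have hF : ∀ {u v w : P}, φ u ∈ M.closure {φ a, φ b, φ c} → φ v ∈ M.closure {φ a, φ b, φ c} →
        u ≠ v → Col M (φ u) (φ v) (φ w) → φ w ∈ M.closure {φ a, φ b, φ c} := by
      intro u v w hu hv huv hcol
      have h1 : M.closure {φ u, φ v} ⊆ M.closure {φ a, φ b, φ c} :=
        M.closure_subset_closure_of_subset_closure (by rintro t (rfl | rfl) <;> assumption)
      exact h1 (hcol.mem_closure (h.par u v huv) (h.nonloop w).mem_ground)
    have hab : a ≠ b := fun hab => ne_of_not_par (not_par_of_not_col hn) (congrArg φ hab)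
    obtain ⟨l, hal, hbl⟩ := h.exists_line a b
    have hcl : c ∉ l := fun hcl => hn (h.col l a b c hal hbl hcl)
    -- Each point `t` lies on a line joining `c` to a point `s` of `ab`, so the images of `a, b, c`
    -- span.
    calc M.eRk (range φ) ≤ M.eRk (M.closure {φ a, φ b, φ c}) := by
          refine M.eRk_mono ?_
          rintro _ ⟨t, rfl⟩
          obtain ⟨m, htm, hcm⟩ := h.exists_line t c
          have hml : m ≠ l := fun hml => hcl (hml ▸ hcm)
          obtain ⟨hsm, hsl⟩ := HasPoints.mkPoint_ax (P := P) hml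
          set s : P := HasPoints.mkPoint hml
          have hsc : s ≠ c := fun hsc => hcl (hsc ▸ hsl)
          exact hF (hF (hsub (by simp)) (hsub (by simp)) hab (h.col l a b s hal hbl hsl))
            (hsub (by simp)) hsc (h.col m s c t hsm hcm htm)
      _ = M.eRk {φ a, φ b, φ c} := M.eRk_closure_eq _
      _ ≤ ({φ a, φ b, φ c} : Set α).encard := M.eRk_le_encard _
      _ ≤ 3 := (encard_insert_le _ _).trans
          ((add_le_add_left (encard_pair_le_two (φ b) (φ c)) 1).trans (by norm_num))
  · have h3 : 3 ≤ M.eRk {φ a, φ b, φ c} :=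
      le_trans (by norm_num) (Order.add_one_le_of_lt (not_le.1 hn))
    exact h3.trans (M.eRk_mono (by rintro _ (rfl | rfl | rfl) <;> exact mem_range_self _))

theorem exists_two_points [Finite P] [Finite L] (l : L) : ∃ u v : P, u ≠ v ∧ u ∈ l ∧ v ∈ l := by
  have h1 := ProjectivePlane.two_lt_pointCount (P := P) l
  have : Nontrivial {u : P // u ∈ l} := by
    rw [← Finite.one_lt_card_iff_nontrivial]
    exact lt_trans one_lt_two h1
  obtain ⟨u, v, huv⟩ := exists_pair_ne {u : P // u ∈ l}
  exact ⟨u, v, fun h => huv (Subtype.ext h), u.2, v.2⟩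

theorem exists_third_point [Finite P] [Finite L] (l : L) (u v : P) :
    ∃ w : P, w ∈ l ∧ w ≠ u ∧ w ≠ v := by
  by_contra! hcon
  have h1 := ProjectivePlane.two_lt_pointCount (P := P) l
  have h2 : {w : P | w ∈ l} ⊆ {u, v} := fun w hw => by
    by_cases hwu : w = u
    · exact Or.inl hwu
    · exact Or.inr (hcon w hw hwu)
  have h3 : {w : P | w ∈ l}.ncard ≤ 2 :=
    (Set.ncard_le_ncard h2 (Set.toFinite _)).trans (Set.ncard_insert_le _ _ |>.trans (by simp))
  exact absurd h3 (not_le.2 h1)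

variable [Finite P] [Finite L]

/-- The line of the matroid that corresponds to a line of the plane. -/
def PlaneMap.line (h : PlaneMap M L φ) (l : L) : Line (M.restrict (range φ)) :=
  ⟨φ '' {w | w ∈ l}, by
    obtain ⟨u, v, huv, hu, hv⟩ := exists_two_points (P := P) l
    rw [← h.closure_pair huv hu hv]
    refine ⟨Matroid.isFlat_closure _, ?_⟩
    rw [Matroid.eRk_closure_eq, (h.indep_pair u v).eRk_eq_encard,
      encard_pair (h.injective.ne huv)]⟩

theorem PlaneMap.mem_line (h : PlaneMap M L φ) (u : P) (l : L) (hu : φ u ∈ (M.restrict (range φ)).E) :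
    (⟨φ u, hu⟩ : (M.restrict (range φ)).E) ∈ h.line l ↔ u ∈ l := by
  change φ u ∈ φ '' {w | w ∈ l} ↔ _
  rw [h.injective.mem_set_image]
  rfl

theorem PlaneMap.line_bijective (h : PlaneMap M L φ) : Function.Bijective h.line := by
  constructor
  · intro l m hlm
    obtain ⟨u, v, huv, hu, hv⟩ := exists_two_points (P := P) l
    have key : ∀ w ∈ l, w ∈ m := fun w hw =>
      (h.mem_line w m (mem_range_self _)).1 (hlm ▸ (h.mem_line w l (mem_range_self _)).2 hw)
    exact (Nondegenerate.eq_or_eq hu hv (key u hu) (key v hv)).resolve_left huv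
  · rintro ⟨F, hF, hr⟩
    obtain ⟨I, hI⟩ := (M.restrict (range φ)).exists_isBasis F hF.subset_ground
    have h2 := hI.encard_eq_eRk
    rw [hr] at h2
    obtain ⟨a, b, hab, rfl⟩ := encard_eq_two.1 h2
    obtain ⟨u, rfl⟩ := hI.indep.subset_ground (show a ∈ ({a, b} : Set α) by simp)
    obtain ⟨v, rfl⟩ := hI.indep.subset_ground (show b ∈ ({φ u, b} : Set α) by simp)
    have huv : u ≠ v := fun h' => hab (congrArg φ h')
    obtain ⟨l, hu, hv⟩ := h.exists_line u v
    refine ⟨l, Subtype.ext ?_⟩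
    change φ '' {w | w ∈ l} = F
    rw [← h.closure_pair huv hu hv, hI.closure_eq_closure, hF.closure]

/-- The image of a plane in a matroid is isomorphic to the plane. -/
theorem PlaneMap.isDesarguesianPlane (h : PlaneMap M L φ) (hD : Desarguesian P L) :
    IsDesarguesianPlane (M.restrict (range φ)) (ProjectivePlane.order P L) := by
  let e : P ≃ (M.restrict (range φ)).E := Equiv.ofInjective φ h.injective
  let g : L ≃ Line (M.restrict (range φ)) := Equiv.ofBijective h.line h.line_bijective
  have heg : ∀ u l, e u ∈ g l ↔ u ∈ l := fun u l => h.mem_line u l _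
  exact {
    simple := by
      rintro _ ⟨u, rfl⟩ _ ⟨v, rfl⟩
      exact h.indep_pair u v
    rank := h.eRank_eq
    plane := ⟨planeOfEquiv e g heg, order_planeOfEquiv e g heg⟩
    desargues := hD.of_equiv e g heg }

end PlaneMap

/-! ### Harmonic closedness of an embedded plane -/

section PlaneClosed

open Configuration

variable {α : Type u} {M : Matroid α} {P L : Type*} [Membership P L] [ProjectivePlane P L]
  [Finite P] [Finite L] {φ : P → α}

/-- Every line has at least three points, so `q` can be chosen on `oy` away from `o` and `y`. Then
`s` is the meet of `oz` and `qx`, and `r` the meet of `ys` and `zq`. -/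
theorem PlaneMap.exists_quad (h : PlaneMap M L φ) {y x z : P} {n : L} (hyx : y ≠ x) (hyz : y ≠ z)
    (hxz : x ≠ z) (hy : y ∈ n) (hx : x ∈ n) (hz : z ∈ n) :
    ∃ o q r s, o ∉ n ∧ Quad M (φ y) (φ x) (φ z) (φ o) (φ q) (φ r) (φ s) := by
  have E : ∀ (a b : P) (l m : L), a ∈ l → b ∈ l → a ∈ m → b ∈ m → a = b ∨ l = m :=
    fun _ _ _ _ => Nondegenerate.eq_or_eq
  have meet : ∀ l m : L, l ≠ m → ∃ a : P, a ∈ l ∧ a ∈ m := fun _ _ hlm =>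
    ⟨_, HasPoints.mkPoint_ax hlm⟩
  obtain ⟨o, ho⟩ := Nondegenerate.exists_point (P := P) n
  obtain ⟨l₁, ho₁, hy₁⟩ := h.exists_line o y
  obtain ⟨q, hq₁, hqo, hqy⟩ := exists_third_point l₁ o y
  obtain ⟨l₂, ho₂, hz₂⟩ := h.exists_line o z
  obtain ⟨l₃, hq₃, hx₃⟩ := h.exists_line q x
  have hqn : q ∉ n := by grind
  have hq₂ : q ∉ l₂ := by grind
  obtain ⟨s, hs₂, hs₃⟩ := meet l₂ l₃ (by grind)
  have hso : s ≠ o := by grind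
  have hsn : s ∉ n := by grind
  have hsq : s ≠ q := by grind
  obtain ⟨l₄, hy₄, hs₄⟩ := h.exists_line y s
  obtain ⟨l₅, hz₅, hq₅⟩ := h.exists_line z q
  have hs₁ : s ∉ l₁ := by grind
  have hq₄ : q ∉ l₄ := by grind
  obtain ⟨r, hr₄, hr₅⟩ := meet l₄ l₅ (by grind)
  have hrq : r ≠ q := by grind
  have hrz : r ≠ z := by grind
  refine ⟨o, q, r, s, ho, ?_, ?_, ?_, ?_, h.col l₁ _ _ _ hy₁ ho₁ hq₁, h.col l₄ _ _ _ hy₄ hr₄ hs₄,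
    h.col l₂ _ _ _ hz₂ ho₂ hs₂, h.col l₅ _ _ _ hz₅ hq₅ hr₅, h.col l₃ _ _ _ hx₃ hq₃ hs₃,
    h.col n _ _ _ hy hx hz, h.nonloop y, h.nonloop x, h.nonloop z⟩
  all_goals
    rw [h.col_iff]
    rintro ⟨m, h₁, h₂, h₃⟩
    grind

/-- The image of a plane in a harmonic matroid is harmonically closed. -/
theorem PlaneMap.mem_range_of_hc (h : PlaneMap M L φ) (hM : IsHarmonic M) {y x z : P} {t : α}
    (hc : HC M (φ y) (φ z) (φ x) t) : t ∈ range φ := by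
  obtain ⟨n, hy, hx, hz, hyx, hyz, hxz⟩ : ∃ n : L, y ∈ n ∧ x ∈ n ∧ z ∈ n ∧ y ≠ x ∧ y ≠ z ∧
      x ≠ z := by
    obtain ⟨o, q, r, s, ⟨hnd, -, hI⟩, -⟩ := hc
    have hcol : Col M (φ y) (φ x) (φ z) := by
      by_contra hn
      have hi := indep_triple_of_not_col hn
      have hsub : {φ y, φ x, φ z} ⊆ hpSet (φ y) (φ x) (φ z) o q r s := by
        rintro a (rfl | rfl | rfl) <;> simp [hpSet]
      rcases hI with hI | hI
      · exact ((hI _ hsub).1 hi).2 (by simp [fanoLines, nonFanoLines])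
      · exact ((hI _ hsub).1 hi).2 (by simp [nonFanoLines])
    obtain ⟨n, hn⟩ := h.col_iff.1 hcol
    refine ⟨n, hn.1, hn.2.1, hn.2.2, ?_, ?_, ?_⟩ <;> rintro rfl <;> simp at hnd
  -- The quadrangle that witnesses `hc` need not lie in the plane. By uniqueness of the conjugate it
  -- may be replaced by one that does, whose side `or` meets `n` in a point of the plane.
  obtain ⟨o, q, r, s, hon, hQ⟩ := h.exists_quad hyx hyz hxz hy hx hz
  obtain ⟨m, hom, hrm⟩ := h.exists_line o r
  obtain ⟨htm, htn⟩ := HasPoints.mkPoint_ax (P := P) (fun hmn => hon (hmn ▸ hom) : m ≠ n)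
  have ht := hQ.hc hM (h.nonloop _).mem_ground (h.col n _ _ _ hy hz htn)
    (h.col m _ _ _ hom hrm htm)
  exact ⟨_, hM.unique_conj _ _ _ _ _ ht hc⟩

end PlaneClosed

/-! ### Desargues' theorem and the order of the plane over a field -/

section FieldPlane

open Configuration Projectivization

variable {K : Type*} [Field K]

theorem mem_iff_dotProduct_rep (v w : ℙ K (Fin 3 → K)) : v ∈ w ↔ v.rep ⬝ᵥ w.rep = 0 := by
  rw [ofField.mem_iff]
  conv_lhs => rw [← v.mk_rep, ← w.mk_rep]
  exact orthogonal_mk _ _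

theorem collinear_mk_iff {a b c : Fin 3 → K} (ha : a ≠ 0) (hb : b ≠ 0) (hc : c ≠ 0) :
    Collinear₃ (ℙ K (Fin 3 → K)) (mk K a ha) (mk K b hb) (mk K c hc) ↔
      (Matrix.of ![a, b, c]).det = 0 := by
  rw [← Matrix.exists_mulVec_eq_zero_iff]
  constructor
  · rintro ⟨l, h₁, h₂, h₃⟩
    induction l with | h n hn =>
    refine ⟨n, hn, ?_⟩
    ext i
    fin_cases i
    exacts [h₁, h₂, h₃]
  · rintro ⟨n, hn, h⟩
    exact ⟨mk K n hn, congrFun h 0, congrFun h 1, congrFun h 2⟩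

theorem linearIndependent_rep_iff {a b c : ℙ K (Fin 3 → K)} :
    LinearIndependent K ![a.rep, b.rep, c.rep] ↔ ¬ Collinear₃ (ℙ K (Fin 3 → K)) a b c := by
  have h := collinear_mk_iff a.rep_nonzero b.rep_nonzero c.rep_nonzero
  rw [mk_rep, mk_rep, mk_rep] at h
  rw [h, ← ne_eq, ← isUnit_iff_ne_zero, ← Matrix.isUnit_iff_isUnit_det,
    ← Matrix.linearIndependent_rows_iff_isUnit]
  rfl

theorem exists_smul_rep_of_collinear {a b c : ℙ K (Fin 3 → K)} {l : ℙ K (Fin 3 → K)}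
    (hab : a ≠ b) (ha : a ∈ l) (hb : b ∈ l) (hc : c ∈ l) :
    ∃ s t : K, c.rep = s • a.rep + t • b.rep := by
  have h1 : ¬ LinearIndependent K ![c.rep, a.rep, b.rep] := fun h =>
    linearIndependent_rep_iff.1 h ⟨l, hc, ha, hb⟩
  have h2 : LinearIndependent K ![a.rep, b.rep] := by
    have := (independent_pair_iff_ne a b).2 hab
    rw [independent_iff] at this
    have h3 : Projectivization.rep ∘ ![a, b] = ![a.rep, b.rep] := by
      ext i
      fin_cases i <;> rfl
    rwa [h3] at this
  have h3 : c.rep ∈ Submodule.span K (range ![a.rep, b.rep]) := by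
    by_contra hn
    exact h1 (linearIndependent_finCons.2 ⟨h2, hn⟩)
  rw [Matrix.range_cons, Matrix.range_cons, Matrix.range_empty, union_empty,
    singleton_union] at h3
  obtain ⟨s, t, hst⟩ := Submodule.mem_span_pair.1 h3
  exact ⟨s, t, hst.symm⟩

theorem eq_of_rep_eq_smul {a b : ℙ K (Fin 3 → K)} {s : K} (h : a.rep = s • b.rep) : a = b := by
  rw [← a.mk_rep, ← b.mk_rep, mk_eq_mk_iff']
  exact ⟨s, h.symm⟩

/-- Normalized coordinates of two points on a line through `o`. -/
theorem exists_perspective_rep {o a a' l : ℙ K (Fin 3 → K)} (ho : o ∈ l) (ha : a ∈ l)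
    (ha' : a' ∈ l) (hoa : o ≠ a) (hoa' : o ≠ a') (haa' : a ≠ a') :
    ∃ (A : Fin 3 → K) (s t : K), s ≠ 0 ∧ a.rep = s • A ∧ a'.rep = t • (o.rep + A) := by
  obtain ⟨s, t, h⟩ := exists_smul_rep_of_collinear hoa ho ha ha'
  have hs : s ≠ 0 := by
    rintro rfl
    rw [zero_smul, zero_add] at h
    exact haa' (eq_of_rep_eq_smul h).symm
  have ht : t ≠ 0 := by
    rintro rfl
    rw [zero_smul, add_zero] at h
    exact hoa' (eq_of_rep_eq_smul h).symm
  -- With `o`, `a`, `a'` denoting representatives, `a' = s o + t a = s (o + A)` for `A = (t / s) a`.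
  refine ⟨(t / s) • a.rep, s / t, s, div_ne_zero hs ht, ?_, ?_⟩
  · rw [smul_smul, div_mul_div_cancel₀ ht, div_self hs, one_smul]
  · rw [h, smul_add, smul_smul, mul_div_cancel₀ _ hs]

/-- The meet of two corresponding sides of perspective triangles. -/
theorem exists_side_rep {o b c b' c' u l₂ l₃ m n : ℙ K (Fin 3 → K)} {B C : Fin 3 → K}
    {s t s' t' : K} (hs : s ≠ 0) (ht : t ≠ 0) (hb : b.rep = s • B) (hb' : b'.rep = s' • (o.rep + B))
    (hc : c.rep = t • C) (hc' : c'.rep = t' • (o.rep + C)) (hl : l₂ ≠ l₃)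
    (ho₂ : o ∈ l₂) (hb₂ : b ∈ l₂) (hb'₂ : b' ∈ l₂) (ho₃ : o ∈ l₃) (hc₃ : c ∈ l₃) (hc'₃ : c' ∈ l₃)
    (hob : o ≠ b) (hoc : o ≠ c) (hob' : o ≠ b') (hbm : b ∈ m) (hcm : c ∈ m) (hum : u ∈ m)
    (hbn : b' ∈ n) (hcn : c' ∈ n) (hun : u ∈ n) : ∃ k : K, k ≠ 0 ∧ u.rep = k • (B - C) := by
  have E : ∀ {a b l m : ℙ K (Fin 3 → K)}, a ∈ l → b ∈ l → a ∈ m → b ∈ m → a = b ∨ l = m :=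
    fun h₁ h₂ h₃ h₄ => Nondegenerate.eq_or_eq h₁ h₂ h₃ h₄
  have hbc' : b' ≠ c' := by
    rintro rfl
    exact (E ho₂ hb'₂ ho₃ hc'₃).elim hob' hl
  have hom : o ∉ m := fun hom =>
    hl (((E ho₂ hb₂ hom hbm).resolve_left hob).trans ((E ho₃ hc₃ hom hcm).resolve_left hoc).symm)
  obtain ⟨x, y, hxy⟩ := exists_smul_rep_of_collinear hbc' hbn hcn hun
  rw [mem_iff_dotProduct_rep] at hbm hcm hum hom
  rw [hb, smul_dotProduct, smul_eq_mul] at hbm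
  rw [hc, smul_dotProduct, smul_eq_mul] at hcm
  have hB := (mul_eq_zero.1 hbm).resolve_left hs
  have hC := (mul_eq_zero.1 hcm).resolve_left ht
  rw [hxy, hb', hc'] at hum
  simp only [add_dotProduct, smul_dotProduct, smul_eq_mul, hB, hC, add_zero] at hum
  -- Pair `u = x b' + y c'` with the normal vector of `m`: it kills `B` and `C` but not `o`. So the
  -- coefficient of `o` vanishes, leaving a multiple of `B - C`.
  have hk : x * s' + y * t' = 0 :=
    (mul_eq_zero.1 (show (x * s' + y * t') * (o.rep ⬝ᵥ m.rep) = 0 by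
      linear_combination hum)).resolve_right hom
  have hu : u.rep = (x * s') • (B - C) := by
    rw [hxy, hb', hc']
    ext i
    simp only [Pi.add_apply, Pi.smul_apply, Pi.sub_apply, smul_eq_mul]
    linear_combination (o.rep i + C i) * hk
  refine ⟨x * s', ?_, hu⟩
  intro h0
  rw [h0, zero_smul] at hu
  exact u.rep_nonzero hu

/-- Desargues' theorem in the projective plane over a field. -/
theorem desarguesian_field : Desarguesian (ℙ K (Fin 3 → K)) (ℙ K (Fin 3 → K)) := by
  classical
  intro o a b c a' b' c' u v w l₁ l₂ l₃ m₁ m₂ m₃ n₁ n₂ n₃ h₁₂ h₂₃ h₁₃ ho₁ ha ha' ho₂ hb hb' ho₃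
    hc hc' hoa hob hoc hoa' hob' hoc' haa' hbb' hcc' _ _ hbm hcm hbn hcn hum hun hcm₂ ham₂ hcn₂
    han₂ hvm hvn ham₃ hbm₃ han₃ hbn₃ hwm hwn
  obtain ⟨A, s₁, t₁, hs₁, hA, hA'⟩ := exists_perspective_rep ho₁ ha ha' hoa hoa' haa'
  obtain ⟨B, s₂, t₂, hs₂, hB, hB'⟩ := exists_perspective_rep ho₂ hb hb' hob hob' hbb'
  obtain ⟨C, s₃, t₃, hs₃, hC, hC'⟩ := exists_perspective_rep ho₃ hc hc' hoc hoc' hcc'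
  obtain ⟨k₁, hk₁, hu⟩ := exists_side_rep hs₂ hs₃ hB hB' hC hC' h₂₃ ho₂ hb hb' ho₃ hc hc'
    hob hoc hob' hbm hcm hum hbn hcn hun
  obtain ⟨k₂, hk₂, hv⟩ := exists_side_rep hs₃ hs₁ hC hC' hA hA' h₁₃.symm ho₃ hc hc' ho₁ ha ha'
    hoc hoa hoc' hcm₂ ham₂ hvm hcn₂ han₂ hvn
  obtain ⟨k₃, hk₃, hw⟩ := exists_side_rep hs₁ hs₂ hA hA' hB hB' h₁₂ ho₁ ha ha' ho₂ hb hb'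
    hoa hob hoa' ham₃ hbm₃ hwm han₃ hbn₃ hwn
  by_contra hn
  have hli := linearIndependent_rep_iff.2 hn
  -- The dependency is `(B - C) + (C - A) + (A - B) = 0`.
  have h0 := Fintype.linearIndependent_iff.1 hli ![k₁⁻¹, k₂⁻¹, k₃⁻¹] (by
    simp only [Fin.sum_univ_three, Matrix.cons_val, hu, hv, hw, smul_smul, inv_mul_cancel₀ hk₁,
      inv_mul_cancel₀ hk₂, inv_mul_cancel₀ hk₃, one_smul]
    abel) 0
  exact inv_ne_zero hk₁ h0

/-- The number of points is `n ^ 2 + n + 1` for order `n`, and `p ^ 2 + p + 1` by counting vectors.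
-/
theorem order_field (p : ℕ) [Fact p.Prime] :
    ProjectivePlane.order (ℙ (ZMod p) (Fin 3 → ZMod p)) (ℙ (ZMod p) (Fin 3 → ZMod p)) = p := by
  classical
  have : Fintype (ℙ (ZMod p) (Fin 3 → ZMod p)) := Fintype.ofFinite _
  have h1 := ProjectivePlane.card_points (ℙ (ZMod p) (Fin 3 → ZMod p))
    (ℙ (ZMod p) (Fin 3 → ZMod p))
  have h2 := Projectivization.card_of_finrank (ZMod p) (Fin 3 → ZMod p) (n := 3) (by simp)
  rw [Nat.card_eq_fintype_card, h1] at h2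
  simp [Finset.sum_range_succ] at h2
  nlinarith

end FieldPlane

/-! ### From affine incidences to a map of `PG(2,p)` -/

section Coordinates

open Configuration Projectivization

variable {α : Type u} {M : Matroid α} {p : ℕ} [Fact p.Prime]

variable (p) in
/-- The point with homogeneous coordinates `[k, i, 1]`. -/
def ptX (k i : ZMod p) : Point p := mk (ZMod p) ![k, i, 1] fun h => by simpa using congrFun h 2

theorem point_cases (u : Point p) :
    (∃ k i, u = ptX p k i) ∨ (∃ s, u = ptC p s) ∨ u = ptD p := by
  induction u using Projectivization.ind with | h v hv =>
  by_cases h2 : v 2 = 0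
  · right
    by_cases h0 : v 0 = 0
    · right
      refine (mk_eq_mk_iff' _ _ _ _ _).2 ⟨v 1, ?_⟩
      ext i
      fin_cases i <;> simp [h0, h2]
    · left
      refine ⟨v 1 / v 0, (mk_eq_mk_iff' _ _ _ _ _).2 ⟨v 0, ?_⟩⟩
      ext i
      fin_cases i <;> simp [h2, mul_div_cancel₀ _ h0]
  · left
    refine ⟨v 0 / v 2, v 1 / v 2, (mk_eq_mk_iff' _ _ _ _ _).2 ⟨v 2, ?_⟩⟩
    ext i
    fin_cases i <;> simp [mul_div_cancel₀ _ h2]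

open Classical in
/-- The map from `PG(2,p)` to a matroid that is given by the images `X k i` of the points
`[k, i, 1]`, `W s` of the points `[1, s, 0]` and `D` of `[0, 1, 0]`. -/
noncomputable def coordMap (D : α) (X : ZMod p → ZMod p → α) (W : ZMod p → α) (u : Point p) : α :=
  if u.rep 2 ≠ 0 then X (u.rep 0 / u.rep 2) (u.rep 1 / u.rep 2)
  else if u.rep 0 ≠ 0 then W (u.rep 1 / u.rep 0) else D

variable {D : α} {X : ZMod p → ZMod p → α} {W : ZMod p → α}

theorem coordMap_ptX (k i : ZMod p) : coordMap D X W (ptX p k i) = X k i := by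
  obtain ⟨a, ha⟩ := exists_smul_eq_mk_rep (ZMod p) ![k, i, 1]
    (fun h => by simpa using congrFun h 2)
  have ha' : (ptX p k i).rep = a • ![k, i, 1] := ha.symm
  simp [coordMap, ha', Units.smul_def]

theorem coordMap_ptC (s : ZMod p) : coordMap D X W (ptC p s) = W s := by
  obtain ⟨a, ha⟩ := exists_smul_eq_mk_rep (ZMod p) ![1, s, 0]
    (fun h => by simpa using congrFun h 0)
  have ha' : (ptC p s).rep = a • ![1, s, 0] := ha.symm
  simp [coordMap, ha', Units.smul_def]

theorem coordMap_ptD : coordMap D X W (ptD p) = D := by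
  obtain ⟨a, ha⟩ := exists_smul_eq_mk_rep (ZMod p) (![0, 1, 0] : Fin 3 → ZMod p)
    (fun h => by simpa using congrFun h 1)
  have ha' : (ptD p).rep = a • ![0, 1, 0] := ha.symm
  simp [coordMap, ha']

theorem ptX_mem_mk {k i : ZMod p} {n : Fin 3 → ZMod p} (hn : n ≠ 0) :
    (ptX p k i : Point p) ∈ (mk (ZMod p) n hn : Point p) ↔ k * n 0 + i * n 1 + n 2 = 0 := by
  rw [ofField.mem_iff, ptX, orthogonal_mk]
  simp [dotProduct, Fin.sum_univ_three]

theorem ptC_mem_mk {s : ZMod p} {n : Fin 3 → ZMod p} (hn : n ≠ 0) :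
    (ptC p s : Point p) ∈ (mk (ZMod p) n hn : Point p) ↔ n 0 + s * n 1 = 0 := by
  rw [ofField.mem_iff, ptC, orthogonal_mk]
  simp [dotProduct, Fin.sum_univ_three]

theorem ptD_mem_mk {n : Fin 3 → ZMod p} (hn : n ≠ 0) :
    (ptD p : Point p) ∈ (mk (ZMod p) n hn : Point p) ↔ n 1 = 0 := by
  rw [ofField.mem_iff, ptD, orthogonal_mk]
  simp [dotProduct, Fin.sum_univ_three]

/-- An affine plane of lines through `D` in a matroid extends to a copy of `PG(2,p)`. -/
theorem AffineConf.planeMap (h : AffineConf M D X W) :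
    PlaneMap M (Point p) (coordMap D X W) where
  col l := by
    suffices ∃ a b, ¬ Par M a b ∧ ∀ u ∈ l, Col M a b (coordMap D X W u) by
      obtain ⟨a, b, hab, hl⟩ := this
      exact fun u v w hu hv hw => Col.trans₃ hab (hl u hu) (hl v hv) (hl w hw)
    induction l using Projectivization.ind with | h n hn =>
    -- Here `n` is the normal vector of the line. The cases are the line at infinity, the lines `x =
    -- -n 2 / n 0`, and the lines of slope `-n 0 / n 1` and intercept `-n 2 / n 1`.
    by_cases h1 : n 1 = 0
    · by_cases h0 : n 0 = 0
      · have h2 : n 2 ≠ 0 := fun h2 => hn (by ext i; fin_cases i <;> assumption)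
        refine ⟨D, W 0, not_par_of_not_col (c := X 0 0) fun hc => h.ncXW 0 0 0 hc.swap_right, ?_⟩
        intro u hu
        obtain ⟨k, i, rfl⟩ | ⟨s, rfl⟩ | rfl := point_cases u
        · rw [ptX_mem_mk] at hu
          simp [h0, h1, h2] at hu
        · rw [coordMap_ptC]
          exact h.colW _ _
        · rw [coordMap_ptD]
          exact col_left M _ _
      · refine ⟨D, X (-(n 2) / n 0) 0, not_par_of_not_col (h.ncXW _ 0 0), ?_⟩
        intro u hu
        obtain ⟨k, i, rfl⟩ | ⟨s, rfl⟩ | rfl := point_cases u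
        · rw [ptX_mem_mk, h1] at hu
          have hk : k = -(n 2) / n 0 := by
            rw [eq_div_iff h0]
            linear_combination hu
          rw [coordMap_ptX, hk]
          exact h.colX _ _ _
        · rw [ptC_mem_mk] at hu
          simp [h0, h1] at hu
        · rw [coordMap_ptD]
          exact col_left M _ _
    · refine ⟨X 0 (-(n 2) / n 1), W (-(n 0) / n 1),
        fun hp => h.ncXW 0 _ _ (hp.col D).rotate.rotate, ?_⟩
      intro u hu
      obtain ⟨k, i, rfl⟩ | ⟨s, rfl⟩ | rfl := point_cases u
      · rw [ptX_mem_mk] at hu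
        have hi : i = -(n 2) / n 1 + k * (-(n 0) / n 1) := by
          field_simp
          linear_combination hu
        rw [coordMap_ptX, hi]
        exact h.col _ _ _
      · rw [ptC_mem_mk] at hu
        have hs : s = -(n 0) / n 1 := by
          rw [eq_div_iff h1]
          linear_combination hu
        rw [coordMap_ptC, hs]
        exact col_right M _ _
      · rw [ptD_mem_mk] at hu
        exact absurd hu h1
  par u v huv hp := by
    have hXW : ∀ k i s, ¬ Par M (X k i) (W s) := fun k i s hp =>
      h.ncXW k i s (hp.col D).rotate.rotate
    have hXD : ∀ k i, ¬ Par M (X k i) D := fun k i hp => h.ncXW k i 0 (hp.col (W 0)).swap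
    have hWD : ∀ s, ¬ Par M (W s) D := fun s hp => h.ncXW 0 0 s (hp.col (X 0 0)).rotate
    obtain ⟨k, i, rfl⟩ | ⟨s, rfl⟩ | rfl := point_cases u <;>
      obtain ⟨l, j, rfl⟩ | ⟨t, rfl⟩ | rfl := point_cases v <;>
      simp only [coordMap_ptX, coordMap_ptC, coordMap_ptD] at hp
    · by_cases hkl : k = l
      · subst hkl
        exact h.parX k i j (fun hij => huv (by rw [hij])) hp
      · exact h.ncXX k l i j hkl (hp.col D).rotate.rotate
    · exact hXW _ _ _ hp
    · exact hXD _ _ hp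
    · exact hXW _ _ _ hp.symm
    · exact h.parW s t (fun hst => huv (by rw [hst])) hp
    · exact hWD _ hp
    · exact hXD _ _ hp.symm
    · exact hWD _ hp.symm
    · exact huv rfl
  not_col := ⟨ptD p, ptX p 0 0, ptC p 0, by
    rw [coordMap_ptX, coordMap_ptC, coordMap_ptD]
    exact h.ncXW 0 0 0⟩

end Coordinates

/-! ### The embedded `L_p` and its harmonic closure -/

section Embedding

open Configuration Projectivization

variable {α : Type u} {M : Matroid α} {p : ℕ} [Fact p.Prime] {f : Point p → α}

theorem PG2_indep_triple {u v w : Point p} (huv : u ≠ v) (huw : u ≠ w) (hvw : v ≠ w) :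
    (PG2 p).Indep {u, v, w} ↔ ¬ Collinear₃ (Point p) u v w := by
  change Independent (Subtype.val : ({u, v, w} : Set (Point p)) → Point p) ↔ _
  rw [independent_iff]
  change LinearIndepOn (ZMod p) Projectivization.rep {u, v, w} ↔ _
  have hinj : Function.Injective ![u, v, w] := by
    intro i j hij
    fin_cases i <;> fin_cases j <;> simp_all [eq_comm]
  have hr : ({u, v, w} : Set (Point p)) = range ![u, v, w] := by
    simp only [Matrix.range_cons, Matrix.range_empty, union_empty, singleton_union]
  rw [hr, linearIndepOn_range_iff hinj, ← linearIndependent_rep_iff]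
  have hc : Projectivization.rep ∘ ![u, v, w] = ![u.rep, v.rep, w.rep] := by
    ext i
    fin_cases i <;> rfl
  rw [hc]

theorem collinear_refl (u v : Point p) : Collinear₃ (Point p) u u v := by
  classical
  by_contra h
  have h1 := linearIndependent_rep_iff.2 h
  exact zero_ne_one (h1.injective (show ![u.rep, u.rep, v.rep] 0 = ![u.rep, u.rep, v.rep] 1 from rfl))

theorem IsEmbedding.col_iff (hf : IsEmbedding (Lp p) M f) {u v w : Point p} (hu : u ∈ LpGround p)
    (hv : v ∈ LpGround p) (hw : w ∈ LpGround p) :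
    Col M (f u) (f v) (f w) ↔ Collinear₃ (Point p) u v w := by
  by_cases huv : u = v
  · subst huv
    exact iff_of_true ((par_self M (f u)).col _) (collinear_refl u w)
  by_cases huw : u = w
  · subst huw
    obtain ⟨l, h1, -, h2⟩ := collinear_refl u v
    exact iff_of_true (col_left M _ _) ⟨l, h1, h2, h1⟩
  by_cases hvw : v = w
  · subst hvw
    obtain ⟨l, h1, -, h2⟩ := collinear_refl v u
    exact iff_of_true (col_right M _ _) ⟨l, h2, h1, h1⟩
  have hsub : ({u, v, w} : Set (Point p)) ⊆ LpGround p := by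
    rintro _ (rfl | rfl | rfl) <;> assumption
  have h1 : M.Indep {f u, f v, f w} ↔ ¬ Collinear₃ (Point p) u v w := by
    rw [← PG2_indep_triple huv huw hvw]
    have h2 := hf.indep_iff {u, v, w} hsub
    rw [image_insert_eq, image_pair] at h2
    rw [← h2, Lp, Matroid.restrict_indep_iff, and_iff_left hsub]
  constructor
  · intro hc
    by_contra hn
    exact not_col_of_indep (h1.2 hn) (hf.injOn.ne hu hv huv) (hf.injOn.ne hu hw huw)
      (hf.injOn.ne hv hw hvw) hc
  · intro hc
    by_contra hn
    exact h1.1 (indep_triple_of_not_col hn) hc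

theorem ptA_mem (i : ZMod p) : ptA p i ∈ LpGround p := by simp [LpGround]

theorem ptB_mem (i : ZMod p) : ptB p i ∈ LpGround p := by simp [LpGround]

theorem ptC_mem (i : ZMod p) : ptC p i ∈ LpGround p := by simp [LpGround]

theorem ptD_mem : ptD p ∈ LpGround p := by simp [LpGround]

/-- The image of `L_p` in a matroid. -/
theorem IsEmbedding.conf (hf : IsEmbedding (Lp p) M f) :
    Conf M (f (ptD p)) (fun i => f (ptA p i)) (fun j => f (ptB p (-j)))
      (fun k => f (ptC p k)) where
  colU i j := by
    rw [hf.col_iff ptD_mem (ptA_mem _) (ptA_mem _), ptD, ptA, ptA, collinear_mk_iff]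
    simp [Matrix.det_fin_three]
  colV i j := by
    rw [hf.col_iff ptD_mem (ptB_mem _) (ptB_mem _), ptD, ptB, ptB, collinear_mk_iff]
    simp [Matrix.det_fin_three]
  colW i j := by
    rw [hf.col_iff ptD_mem (ptC_mem _) (ptC_mem _), ptD, ptC, ptC, collinear_mk_iff]
    simp [Matrix.det_fin_three]
  -- The determinant condition for `[0,i,1]`, `[1,-j,1]`, `[1,k,0]` is `i + j + k = 0`; this is why
  -- `V` carries the sign.
  col i j k hs := by
    rw [hf.col_iff (ptA_mem _) (ptB_mem _) (ptC_mem _), ptA, ptB, ptC, collinear_mk_iff]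
    simp [Matrix.det_fin_three]
    linear_combination hs
  ncUV i j := by
    rw [hf.col_iff ptD_mem (ptA_mem _) (ptB_mem _), ptD, ptA, ptB, collinear_mk_iff]
    simp [Matrix.det_fin_three]
  ncVW i j := by
    rw [hf.col_iff ptD_mem (ptB_mem _) (ptC_mem _), ptD, ptB, ptC, collinear_mk_iff]
    simp [Matrix.det_fin_three]
  ncUW i j := by
    rw [hf.col_iff ptD_mem (ptA_mem _) (ptC_mem _), ptD, ptA, ptC, collinear_mk_iff]
    simp [Matrix.det_fin_three]
  parU i j hij hp := by
    have h1 := hp.col (f (ptB p 0))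
    rw [hf.col_iff (ptA_mem _) (ptA_mem _) (ptB_mem _), ptA, ptA, ptB, collinear_mk_iff] at h1
    simp [Matrix.det_fin_three] at h1
    exact hij (by linear_combination h1)
  parV i j hij hp := by
    have h1 := hp.col (f (ptA p 0))
    rw [hf.col_iff (ptB_mem _) (ptB_mem _) (ptA_mem _), ptB, ptB, ptA, collinear_mk_iff] at h1
    simp [Matrix.det_fin_three] at h1
    exact hij (by linear_combination h1)
  parW i j hij hp := by
    have h1 := hp.col (f (ptA p 0))
    rw [hf.col_iff (ptC_mem _) (ptC_mem _) (ptA_mem _), ptC, ptC, ptA, collinear_mk_iff] at h1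
    simp [Matrix.det_fin_three] at h1
    exact hij (by linear_combination -h1)

/-- The harmonic closure of a copy of `L_p` in a harmonic matroid is a copy of `PG(2,p)`. -/
theorem IsEmbedding.isDesarguesianPlane (hM : IsHarmonic M) (hf : IsEmbedding (Lp p) M f) :
    harmonicClosure M (f '' (Lp p).E) ⊆ M.E ∧
      IsDesarguesianPlane (M.restrict (harmonicClosure M (f '' (Lp p).E))) p := by
  classical
  have hE : (Lp p).E = LpGround p := rfl
  have hmem : ∀ u ∈ LpGround p, f u ∈ harmonicClosure M (f '' (Lp p).E) := fun u hu =>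
    subset_harmonicClosure M _ (mem_image_of_mem f hu)
  obtain ⟨X, hX, h0, h1, hXmem⟩ := hf.conf.exists_affineConf hM (S := f '' (Lp p).E)
    (fun i => hmem _ (ptA_mem i)) (fun i => hmem _ (ptB_mem _)) (fun i => hmem _ (ptC_mem i))
  have hφ := hX.planeMap
  -- The range contains the image of `L_p` and is harmonically closed; conversely each of its points
  -- was constructed inside the closure.
  have hrange : harmonicClosure M (f '' (Lp p).E) =
      range (coordMap (f (ptD p)) X fun k => f (ptC p k)) := by
    apply Subset.antisymm
    · apply harmonicClosure_subset
      · rintro _ ⟨u, hu, rfl⟩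
        rcases hu with ((⟨i, rfl⟩ | ⟨i, rfl⟩) | ⟨i, rfl⟩) | rfl
        · refine ⟨ptX p 0 i, ?_⟩
          rw [coordMap_ptX, h0]
        · refine ⟨ptX p 1 i, ?_⟩
          rw [coordMap_ptX, h1]
          simp
        · exact ⟨ptC p i, coordMap_ptC i⟩
        · exact ⟨ptD p, coordMap_ptD⟩
      · rintro _ ⟨a, rfl⟩ _ ⟨b, rfl⟩ _ ⟨c, rfl⟩ x hx
        exact hφ.mem_range_of_hc hM hx
    · rintro _ ⟨u, rfl⟩
      obtain ⟨k, i, rfl⟩ | ⟨s, rfl⟩ | rfl := point_cases u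
      · rw [coordMap_ptX]
        exact hXmem k i
      · rw [coordMap_ptC]
        exact hmem _ (ptC_mem s)
      · rw [coordMap_ptD]
        exact hmem _ ptD_mem
  rw [hrange]
  refine ⟨hφ.range_subset, ?_⟩
  have h2 := hφ.isDesarguesianPlane desarguesian_field
  rwa [order_field p] at h2

end Embedding

end HarmonicMatroid

theorem theorem4p2 {α : Type*} (p : ℕ) [Fact p.Prime] (M : Matroid α)
    (hM : HarmonicMatroid.IsHarmonic M) (f : HarmonicMatroid.Point p → α)
    (hf : HarmonicMatroid.IsEmbedding (HarmonicMatroid.Lp p) M f) :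
    HarmonicMatroid.harmonicClosure M (f '' (HarmonicMatroid.Lp p).E) ⊆ M.E ∧
      HarmonicMatroid.IsDesarguesianPlane
        (M.restrict (HarmonicMatroid.harmonicClosure M (f '' (HarmonicMatroid.Lp p).E))) p := by
  exact hf.isDesarguesianPlane hM
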